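/- Let $\Lambda=[0,1]^2\subset\mathbb R^2$ and $0<\beta<2$. For $N\ge 1$ and $\vec X_N=(x_1,\dots,x_N)$, $\vec Y_N=(y_1,\dots,y_N)\in\Lambda^N$ let $$W_N(\vec X_N,\vec Y_N)=\sum_{1\le i\ne j\le N}\bigl(-\log|x_i-x_j|-\log|y_i-y_j|\bigr)+2\sum_{1\le i,j\le N}\log|x_i-y_j| ,$$ let $Z_{N,\beta}=\int_{\Lambda^{2N}}e^{-\frac\beta2 W_N}\,d\vec X_N\,d\vec Y_N$, let $\mathbb P_N^\beta$ be the measure on $\Lambda^{2N}$ with density $Z_{N,\beta}^{-1}e^{-\frac\beta2W_N}$, and let $\mu_N^+=\frac1N\sum_{i=1}^N\delta_{x_i}$, $\mu_N^-=\frac1N\sum_{i=1}^N\delta_{y_i}$. Then $\mathbb P_N^\beta$ is a well-defined probability measure for every $N\ge1$. On the set $\mathcal P(\Lambda)$ of Borel probability measures use the Dudley distance $d(P,Q)=\sup\{\int F\,dP-\int F\,dQ:\ F \text{ is 1-Lipschitz on } \Lambda,\ \|F\|_\infty\le1\}$, and on $\mathcal P(\Lambda)^2$ the sum of the distances of the two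 components, with closed balls $B(\cdot,\epsilon)$. For $\mu^+,\mu^-\in\mathcal P(\Lambda)$ put $$H(\mu^+,\mu^-)=\inf\Bigl\{\int_{\mathbb R^2}|E|^2:\ E\in L^2(\mathbb R^2,\mathbb R^2),\ -\operatorname{div}E=2\pi(\mu^+-\mu^-)\text{ in the sense of distributions on }\mathbb R^2\Bigr\}\in[0,+\infty].$$ Then, for all $\mu^+,\mu^-\in\mathcal P(\Lambda)$ (with $\log 0=-\infty$), $$\limsup_{\epsilon\downarrow0}\ \limsup_{N\to\infty}\ \frac1{N^2}\log\mathbb P_N^\beta\bigl((\mu_N^+,\mu_N^-)\in B((\mu^+,\mu^-),\epsilon)\bigr)\ \le\ -\frac\beta2\cdot\frac1{2\pi}\,H(\mu^+,\mu^-).$$ Moreover the infimum defining $H(\mu^+,\mu^-)$ is attained whenever it is finite, and $H(\mu^+,\mu^-)=0$ if and only if $\mu^+=\mu^-$. -/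

import Mathlib

open MeasureTheory Filter Topology
open scoped ENNReal ContDiff

noncomputable section

namespace TwoComponentPlasma

/-- The Euclidean plane. -/
abbrev Plane : Type := EuclideanSpace ℝ (Fin 2)

/-- The unit square `Λ = [0,1]²` as a subset of the plane. -/
def squareSet : Set Plane := {x | ∀ k, x k ∈ Set.Icc (0 : ℝ) 1}

/-- The unit square `Λ` as a space of its own, with the Euclidean distance and the Borel σ-algebra that it
inherits from the plane. -/
abbrev Square : Type := ↥squareSet

/-- Lebesgue measure on the square. -/
def lebSquare : Measure Square :=
  (volume : Measure Plane).comap Subtype.val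

/-- Pairs of `N`-tuples of points of the square: the positive charges and the negative charges. -/
abbrev Config (N : ℕ) : Type := (Fin N → Square) × (Fin N → Square)

/-- Lebesgue measure on `Λ^{2N}`. -/
def lebConfig (N : ℕ) : Measure (Config N) :=
  (Measure.pi fun _ : Fin N => lebSquare).prod (Measure.pi fun _ : Fin N => lebSquare)

/-- The logarithmic interaction energy
`∑_{i ≠ j} (- log |x_i - x_j| - log |y_i - y_j|) + 2 ∑_{i,j} log |x_i - y_j|`. (Coincidences of points
form a Lebesgue-null set.) -/
def energy {N : ℕ} (c : Config N) : ℝ :=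
  (∑ i : Fin N, ∑ j : Fin N,
      if i ≠ j then - Real.log (dist (c.1 i) (c.1 j)) - Real.log (dist (c.2 i) (c.2 j)) else 0)
    + 2 * ∑ i : Fin N, ∑ j : Fin N, Real.log (dist (c.1 i) (c.2 j))

/-- The Boltzmann weight `exp (-(β/2) W_N)`. -/
def weight (β : ℝ) {N : ℕ} (c : Config N) : ℝ≥0∞ :=
  ENNReal.ofReal (Real.exp (-(β / 2) * energy c))

/-- The partition function. -/
def partitionFunction (β : ℝ) (N : ℕ) : ℝ≥0∞ :=
  ∫⁻ c : Config N, weight β c ∂lebConfig N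

/-- The Gibbs measure at inverse temperature `β`. -/
def gibbs (β : ℝ) (N : ℕ) : Measure (Config N) :=
  (partitionFunction β N)⁻¹ • (lebConfig N).withDensity (weight β)

/-- The empirical measure `(1/N) ∑ δ_{x_i}`. -/
def empirical {N : ℕ} (x : Fin N → Square) : Measure Square :=
  (N : ℝ≥0∞)⁻¹ • ∑ i : Fin N, Measure.dirac (x i)

/-- The Dudley (bounded Lipschitz) distance between two finite measures on a metric space: the
supremum of `∫ F d(P - Q)` over the `1`-Lipschitz functions `F` with `‖F‖_∞ ≤ 1`. -/
def dudleyDist {X : Type*} [PseudoMetricSpace X] [MeasurableSpace X] (P Q : Measure X) : ℝ :=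
  sSup {t : ℝ | ∃ F : X → ℝ, LipschitzWith 1 F ∧ (∀ x, |F x| ≤ 1) ∧
    t = ∫ x, F x ∂P - ∫ x, F x ∂Q}

/-- The event that `(μ_N^+, μ_N^-)` lies in the closed ball of radius `ε` around `(μ, ν)`, for the
sum of the Dudley distances of the components. -/
def nearEvent (N : ℕ) (μ ν : Measure Square) (ε : ℝ) : Set (Config N) :=
  {c | dudleyDist (empirical c.1) μ + dudleyDist (empirical c.2) ν ≤ ε}

/-- `E ∈ L²(ℝ²; ℝ²)` and `-div E = 2π (μ - ν)` in the sense of distributions on the whole plane: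
`∫ E · ∇φ = 2π (∫ φ dμ - ∫ φ dν)` for each test function `φ`. -/
def IsElectricField (μ ν : Measure Square) (E : Plane → Plane) : Prop :=
  MemLp E 2 (volume : Measure Plane) ∧
    ∀ φ : Plane → ℝ, ContDiff ℝ ∞ φ → HasCompactSupport φ →
      ∫ x : Plane, fderiv ℝ φ x (E x)
        = 2 * Real.pi * (∫ x : Square, φ x.1 ∂μ - ∫ x : Square, φ x.1 ∂ν)

/-- The `L²` energy `∫ |E|²` of a vector field. -/
def fieldEnergy (E : Plane → Plane) : ℝ≥0∞ :=
  ∫⁻ x : Plane, ‖E x‖ₑ ^ 2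

/-- `H(μ, ν)`, the least energy of a field with `-div E = 2π (μ - ν)` (infinite if there is none). -/
def H (μ ν : Measure Square) : ℝ≥0∞ :=
  ⨅ (E : Plane → Plane) (_ : IsElectricField μ ν E), fieldEnergy E

end TwoComponentPlasma

end

/-! The energy `W_N` is compared with the energy of smeared charges, in which each charge of a pair
interacts through the regularized kernel `-log √(|x - y|² + e + e')` with a parameter `e` of its
own. This kernel is conditionally positive definite (`neg_log_condPosDef`): it is a mixture of
Gaussians, and a Gaussian is the convolution of two narrower ones.

Smear each charge at a scale proportional to its distance `r` to the nearest charge of the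
*opposite* sign. Then the energy of like pairs only decreases, that of opposite pairs increases by
at most `η` each, and the self-energies are `2 N` terms of size `log r`. Hence `W_N` is at least the
smeared energy, minus `O(η N²)`, plus the sum of the `log r` (`energy_ge`). Positivity of the energy
of the smeared charges minus `N (μ - ν)`, smeared at the fixed scale `√τ`, bounds the smeared energy
from below by an expression affine in the empirical measures, which is continuous for the Dudley
distance. The Boltzmann factor of the self-energies, a product of `r ^ (-β / 2)`, is at most `∏
r(x_i) ^ (-β) + ∏ r(y_j) ^ (-β)`; the integral of the first product over the `x_i` with the `y_j`
fixed factorizes, and is of order `(C N) ^ N` because `|x| ^ (-β)` is integrable in the plane for `β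
< 2` (`setLIntegral_weight_le`). This gives `Z_N < ∞`, and, with the lower bound `Z_N ≥ exp (-β N)`
from Jensen's inequality, the upper bound by the regularized energy `chargeEnergy μ ν τ` of `μ - ν`
(`limsup_log_gibbs_le`, `chargeEnergy_le_of_forall`).

The regularized energies are related to `H` by duality. For a test function `φ`, the density `m =
-(2 π)⁻¹ Δ φ` has potential `φ` and energy `(2 π)⁻¹ ∫ |∇ φ|²`. If all regularized energies are at
most `M`, positivity of the energy of `μ - ν - s m` for all real `s` yields `|∫ φ d(μ - ν)|² ≤ M (2
π)⁻¹ ∫ |∇ φ|²`, and the Riesz representation theorem in `L²` produces a field of energy at most `2 π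
M` (`H_le_of_chargeEnergy_le`). The minimum is attained since the fields with the given divergence
form a closed convex set, and a field of energy zero annihilates all test functions. -/

noncomputable section

namespace TwoComponentPlasma

/-! ### Conditional positive definiteness of the regularized logarithm -/

theorem gaussian_mul_gaussian (t : ℝ) (x y u : Plane) :
    Real.exp (-(2 * t) * ‖x - u‖ ^ 2) * Real.exp (-(2 * t) * ‖y - u‖ ^ 2)
      = Real.exp (-t * ‖x - y‖ ^ 2)
        * Real.exp (-(4 * t) * ‖u - (1 / 2 : ℝ) • (x + y)‖ ^ 2) := by
  rw [← Real.exp_add, ← Real.exp_add]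
  congr 1
  simp only [EuclideanSpace.norm_sq_eq, Fin.sum_univ_two, Real.norm_eq_abs, sq_abs, PiLp.sub_apply,
    PiLp.smul_apply, PiLp.add_apply, smul_eq_mul]
  ring

theorem integrable_gaussian {b : ℝ} (hb : 0 < b) (x : Plane) :
    Integrable (fun u : Plane => Real.exp (-b * ‖u - x‖ ^ 2)) := by
  have h : Integrable (fun u : Plane => Real.exp (-b * ‖u‖ ^ 2)) := by
    by_contra h
    have h1 := GaussianFourier.integral_rexp_neg_mul_sq_norm (V := Plane) hb
    rw [integral_undef h] at h1
    have : (0 : ℝ) < (Real.pi / b) ^ (Module.finrank ℝ Plane / 2 : ℝ) := by positivity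
    linarith
  exact h.comp_sub_right x

theorem integral_gaussian_mul_gaussian {t : ℝ} (ht : 0 < t) (x y : Plane) :
    ∫ u : Plane, Real.exp (-(2 * t) * ‖x - u‖ ^ 2) * Real.exp (-(2 * t) * ‖y - u‖ ^ 2)
      = Real.pi / (4 * t) * Real.exp (-t * ‖x - y‖ ^ 2) := by
  simp_rw [gaussian_mul_gaussian]
  rw [integral_const_mul,
    integral_sub_right_eq_self (fun u : Plane => Real.exp (-(4 * t) * ‖u‖ ^ 2)),
    GaussianFourier.integral_rexp_neg_mul_sq_norm (by positivity)]
  simp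
  ring

section

variable {Ω : Type*} [MeasurableSpace Ω] (κ : Measure Ω) [IsFiniteMeasure κ]

/-- The Gaussian kernel is positive definite, because it is the convolution of two narrower
Gaussians. -/
theorem gaussian_posDef {z : Ω → Plane} (hz : Measurable z) {a : Ω → ℝ} (ha : Measurable a)
    {A : ℝ} (hA : ∀ ξ, |a ξ| ≤ A) {t : ℝ} (ht : 0 < t) :
    0 ≤ ∫ p : Ω × Ω, a p.1 * a p.2 * Real.exp (-t * ‖z p.1 - z p.2‖ ^ 2) ∂(κ.prod κ) := by
  set F : (Ω × Ω) → Plane → ℝ := fun p u =>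
    (a p.1 * Real.exp (-(2 * t) * ‖z p.1 - u‖ ^ 2)) *
      (a p.2 * Real.exp (-(2 * t) * ‖z p.2 - u‖ ^ 2)) with hF
  have hFm : Measurable (Function.uncurry F) := by
    simp only [hF, Function.uncurry_def]; fun_prop
  have hrw : ∀ p u, F p u = (a p.1 * a p.2) * (Real.exp (-(2 * t) * ‖z p.1 - u‖ ^ 2) *
      Real.exp (-(2 * t) * ‖z p.2 - u‖ ^ 2)) := fun p u => by simp only [hF]; ring
  have hint1 : ∀ p : Ω × Ω, Integrable (F p) := by
    intro p
    have h := ((integrable_gaussian (b := 4 * t) (by positivity)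
      ((1 / 2 : ℝ) • (z p.1 + z p.2))).const_mul (Real.exp (-t * ‖z p.1 - z p.2‖ ^ 2))).const_mul
        (a p.1 * a p.2)
    refine h.congr (Eventually.of_forall fun u => ?_)
    simp only [hrw, gaussian_mul_gaussian]
  have hval : ∀ p : Ω × Ω, ∫ u, F p u
      = Real.pi / (4 * t) * (a p.1 * a p.2 * Real.exp (-t * ‖z p.1 - z p.2‖ ^ 2)) := by
    intro p
    simp_rw [hrw, integral_const_mul, integral_gaussian_mul_gaussian ht]
    ring
  have hnorm : ∀ p : Ω × Ω, ∫ u, ‖F p u‖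
      = Real.pi / (4 * t) * (|a p.1| * |a p.2| * Real.exp (-t * ‖z p.1 - z p.2‖ ^ 2)) := by
    intro p
    simp_rw [hrw, norm_mul, Real.norm_eq_abs, Real.abs_exp, integral_const_mul,
      integral_gaussian_mul_gaussian ht]
    ring
  have hFi : Integrable (Function.uncurry F) ((κ.prod κ).prod volume) := by
    rw [integrable_prod_iff hFm.aestronglyMeasurable]
    refine ⟨Eventually.of_forall hint1, ?_⟩
    simp only [Function.uncurry_apply_pair, hnorm]
    refine Integrable.of_bound (C := Real.pi / (4 * t) * (A * A * 1)) ?_ ?_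
    · exact Measurable.aestronglyMeasurable (by fun_prop)
    · refine Eventually.of_forall fun p => ?_
      have hA0 : 0 ≤ A := (abs_nonneg _).trans (hA p.1)
      rw [Real.norm_eq_abs, abs_of_nonneg (by positivity)]
      gcongr
      · exact hA _
      · exact hA _
      · rw [Real.exp_le_one_iff]
        have : 0 ≤ t * ‖z p.1 - z p.2‖ ^ 2 := by positivity
        linarith
  have hswap := integral_integral_swap hFi
  simp only [hval, integral_const_mul] at hswap
  have hpos : 0 ≤ ∫ u, ∫ p, F p u ∂(κ.prod κ) := by
    refine integral_nonneg fun u => ?_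
    have := integral_prod_mul (μ := κ) (ν := κ)
      (fun ξ => a ξ * Real.exp (-(2 * t) * ‖z ξ - u‖ ^ 2))
      (fun ξ => a ξ * Real.exp (-(2 * t) * ‖z ξ - u‖ ^ 2))
    simp only [hF, Pi.zero_apply]
    rw [this]
    exact mul_self_nonneg _
  rw [← hswap] at hpos
  have h4 : 0 < Real.pi / (4 * t) := by positivity
  exact (mul_nonneg_iff_of_pos_left h4).1 hpos

/-- The power `w ^ (-δ)` at `w = |z - z'|² + e + e'` is positive definite: by the Gamma integral it is a
mixture of the Gaussians `exp (-t w)`. -/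
theorem rpow_posDef {z : Ω → Plane} (hz : Measurable z) {e q : Ω → ℝ} (he : Measurable e)
    (hq : Measurable q) {A e₀ : ℝ} (hA : ∀ ξ, |q ξ| ≤ A) (he₀ : 0 < e₀) (hee : ∀ ξ, e₀ ≤ e ξ)
    {δ : ℝ} (hδ : 0 < δ) :
    0 ≤ ∫ p : Ω × Ω, q p.1 * q p.2 * (‖z p.1 - z p.2‖ ^ 2 + e p.1 + e p.2) ^ (-δ)
      ∂(κ.prod κ) := by
  have hep : ∀ ξ, 0 < e ξ := fun ξ => he₀.trans_le (hee ξ)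
  have hw : ∀ p : Ω × Ω, 0 < ‖z p.1 - z p.2‖ ^ 2 + e p.1 + e p.2 := fun p => by
    have := hep p.1; have := hep p.2; positivity
  set F : (Ω × Ω) → ℝ → ℝ := fun p t => (q p.1 * q p.2) *
    (t ^ (δ - 1) * Real.exp (-((‖z p.1 - z p.2‖ ^ 2 + e p.1 + e p.2) * t))) with hF
  have hFm : Measurable (Function.uncurry F) := by
    simp only [hF, Function.uncurry_def]; fun_prop
  have hgam : ∀ p : Ω × Ω, ∫ t in Set.Ioi (0 : ℝ),
      t ^ (δ - 1) * Real.exp (-((‖z p.1 - z p.2‖ ^ 2 + e p.1 + e p.2) * t))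
      = Real.Gamma δ * (‖z p.1 - z p.2‖ ^ 2 + e p.1 + e p.2) ^ (-δ) := by
    intro p
    rw [Real.integral_rpow_mul_exp_neg_mul_Ioi hδ (hw p), one_div, Real.inv_rpow (hw p).le,
      Real.rpow_neg (hw p).le, mul_comm]
  have hG : 0 < Real.Gamma δ := Real.Gamma_pos_of_pos hδ
  have hint0 : ∀ p : Ω × Ω, IntegrableOn (fun t : ℝ =>
      t ^ (δ - 1) * Real.exp (-((‖z p.1 - z p.2‖ ^ 2 + e p.1 + e p.2) * t))) (Set.Ioi 0) := by
    intro p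
    by_contra h
    have h1 := hgam p
    rw [integral_undef h] at h1
    have := hw p
    have : 0 < Real.Gamma δ * (‖z p.1 - z p.2‖ ^ 2 + e p.1 + e p.2) ^ (-δ) := by positivity
    linarith
  have hval : ∀ p : Ω × Ω, ∫ t in Set.Ioi (0 : ℝ), F p t = Real.Gamma δ *
      (q p.1 * q p.2 * (‖z p.1 - z p.2‖ ^ 2 + e p.1 + e p.2) ^ (-δ)) := by
    intro p
    simp only [hF, integral_const_mul, hgam]; ring
  have hnorm : ∀ p : Ω × Ω, ∫ t in Set.Ioi (0 : ℝ), ‖F p t‖ = Real.Gamma δ *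
      (|q p.1 * q p.2| * (‖z p.1 - z p.2‖ ^ 2 + e p.1 + e p.2) ^ (-δ)) := by
    intro p
    have : ∀ t ∈ Set.Ioi (0 : ℝ), ‖F p t‖ = |q p.1 * q p.2| * (t ^ (δ - 1) *
        Real.exp (-((‖z p.1 - z p.2‖ ^ 2 + e p.1 + e p.2) * t))) := by
      intro t ht
      have ht : 0 < t := ht
      simp only [hF]
      rw [norm_mul, Real.norm_eq_abs, Real.norm_eq_abs (t ^ (δ - 1) * _),
        abs_of_nonneg (a := t ^ (δ - 1) * _) (by positivity)]
    rw [setIntegral_congr_fun measurableSet_Ioi this, integral_const_mul, hgam]; ring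
  have hFi : Integrable (Function.uncurry F)
      ((κ.prod κ).prod (volume.restrict (Set.Ioi (0 : ℝ)))) := by
    rw [integrable_prod_iff hFm.aestronglyMeasurable]
    refine ⟨Eventually.of_forall fun p => (hint0 p).const_mul (q p.1 * q p.2), ?_⟩
    simp only [Function.uncurry_apply_pair, hnorm]
    refine Integrable.of_bound (C := Real.Gamma δ * (A * A * (e₀ ^ (-δ)))) ?_ ?_
    · exact Measurable.aestronglyMeasurable (by fun_prop)
    · refine Eventually.of_forall fun p => ?_
      have hA0 : 0 ≤ A := (abs_nonneg _).trans (hA p.1)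
      have := hw p
      rw [Real.norm_eq_abs, abs_of_nonneg (by positivity), abs_mul]
      refine mul_le_mul_of_nonneg_left ?_ hG.le
      refine mul_le_mul (mul_le_mul (hA _) (hA _) (abs_nonneg _) hA0) ?_ (by positivity)
        (by positivity)
      refine Real.rpow_le_rpow_of_nonpos he₀ ?_ (by linarith)
      have h1 := hee p.1; have h2 := hep p.2; have h3 := sq_nonneg ‖z p.1 - z p.2‖
      linarith
  have hswap := integral_integral_swap hFi
  simp only [hval, integral_const_mul] at hswap
  have hpos : 0 ≤ ∫ t in Set.Ioi (0 : ℝ), ∫ p, F p t ∂(κ.prod κ) := by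
    refine setIntegral_nonneg measurableSet_Ioi fun t ht => ?_
    have ht : 0 < t := ht
    have h := gaussian_posDef κ hz (a := fun ξ => q ξ * Real.exp (-(t * e ξ))) (by fun_prop)
      (A := A) (fun ξ => by
        rw [abs_mul, Real.abs_exp]
        have h1 : Real.exp (-(t * e ξ)) ≤ 1 := by
          rw [Real.exp_le_one_iff]
          have : 0 ≤ t * e ξ := mul_nonneg ht.le (hep ξ).le
          linarith
        calc |q ξ| * Real.exp (-(t * e ξ)) ≤ |q ξ| * 1 := by gcongr
          _ ≤ A := by rw [mul_one]; exact hA ξ) ht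
    have : ∀ p : Ω × Ω, F p t = t ^ (δ - 1) * (q p.1 * Real.exp (-(t * e p.1)) *
        (q p.2 * Real.exp (-(t * e p.2))) * Real.exp (-t * ‖z p.1 - z p.2‖ ^ 2)) := by
      intro p
      have h2 : Real.exp (-((‖z p.1 - z p.2‖ ^ 2 + e p.1 + e p.2) * t))
          = Real.exp (-(t * e p.1)) * Real.exp (-(t * e p.2)) *
            Real.exp (-t * ‖z p.1 - z p.2‖ ^ 2) := by
        rw [← Real.exp_add, ← Real.exp_add]; congr 1; ring
      simp only [hF, h2]; ring
    simp_rw [this, integral_const_mul]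
    exact mul_nonneg (by positivity) h
  rw [← hswap] at hpos
  exact (mul_nonneg_iff_of_pos_left hG).1 hpos

theorem tendsto_rpow_neg_sub_one_div {w : ℝ} (hw : 0 < w) :
    Tendsto (fun n : ℕ => (w ^ (-(1 / ((n : ℝ) + 1))) - 1) / (1 / ((n : ℝ) + 1))) atTop
      (𝓝 (-Real.log w)) := by
  have hd : HasDerivAt (fun δ : ℝ => w ^ (-δ)) (-Real.log w) 0 := by
    have := (hasDerivAt_neg (0 : ℝ)).const_rpow hw
    simpa using this
  have h := hasDerivAt_iff_tendsto_slope_zero.1 hd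
  have hn : Tendsto (fun n : ℕ => 1 / ((n : ℝ) + 1)) atTop (𝓝[≠] 0) := by
    refine tendsto_nhdsWithin_iff.2 ⟨tendsto_one_div_add_atTop_nhds_zero_nat, ?_⟩
    exact Eventually.of_forall fun n => by
      simp only [Set.mem_compl_iff, Set.mem_singleton_iff]; positivity
  have := h.comp hn
  refine this.congr fun n => ?_
  simp [div_eq_inv_mul]

theorem abs_rpow_neg_sub_one_div_le {w L δ : ℝ} (hw : 0 < w) (hL : |Real.log w| ≤ L)
    (hδ : 0 < δ) (hδ1 : δ ≤ 1) : |(w ^ (-δ) - 1) / δ| ≤ L * Real.exp L := by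
  have hL0 : 0 ≤ L := (abs_nonneg _).trans hL
  obtain ⟨h1, h2⟩ := abs_le.1 hL
  rw [abs_div, abs_of_pos hδ, div_le_iff₀ hδ, Real.rpow_def_of_pos hw]
  set s := Real.log w * -δ with hs
  have hsL : |s| ≤ L * δ := by
    rw [hs, abs_mul, abs_neg, abs_of_pos hδ]; gcongr
  obtain ⟨h3, h4⟩ := abs_le.1 hsL
  have hLd : L * δ ≤ L := by nlinarith
  have he : 1 ≤ Real.exp L := Real.one_le_exp hL0
  have hLd0 : 0 ≤ L * δ := by positivity
  rw [abs_le]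
  constructor
  · have := Real.add_one_le_exp s
    nlinarith
  · have h5 := Real.add_one_le_exp (-s)
    have h6 : Real.exp s * Real.exp (-s) = 1 := by rw [← Real.exp_add]; simp
    have h7 : Real.exp s - 1 ≤ s * Real.exp s := by
      nlinarith [Real.exp_pos s, mul_le_mul_of_nonneg_left h5 (Real.exp_pos s).le]
    have h8 : Real.exp s ≤ Real.exp L := Real.exp_le_exp.2 (by linarith)
    calc Real.exp s - 1 ≤ s * Real.exp s := h7
      _ ≤ (L * δ) * Real.exp s := by gcongr
      _ ≤ (L * δ) * Real.exp L := by gcongr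
      _ = L * Real.exp L * δ := by ring

/-- Conditional positive definiteness of `-log (|z - z'|² + e + e')`, as the limit of
`(w ^ (-δ) - 1) / δ` for `δ → 0`, in which neutrality removes the constant: the logarithmic energy of a
neutral charge distribution, in which the charge at `ξ` is smeared with its own parameter `e ξ`, is
nonnegative. -/
theorem neg_log_condPosDef {z : Ω → Plane} (hz : Measurable z) {e q : Ω → ℝ} (he : Measurable e)
    (hq : Measurable q) {A e₀ R : ℝ} (hA : ∀ ξ, |q ξ| ≤ A) (he₀ : 0 < e₀) (hee : ∀ ξ, e₀ ≤ e ξ)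
    (heR : ∀ ξ, e ξ ≤ R) (hzR : ∀ᵐ ξ ∂κ, ‖z ξ‖ ≤ R) (hneutral : ∫ ξ, q ξ ∂κ = 0) :
    0 ≤ ∫ p : Ω × Ω, q p.1 * q p.2 * (-Real.log (‖z p.1 - z p.2‖ ^ 2 + e p.1 + e p.2))
      ∂(κ.prod κ) := by
  have hep : ∀ ξ, 0 < e ξ := fun ξ => he₀.trans_le (hee ξ)
  have hw : ∀ p : Ω × Ω, 0 < ‖z p.1 - z p.2‖ ^ 2 + e p.1 + e p.2 := fun p => by
    have := hep p.1; have := hep p.2; positivity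
  set L := max |Real.log e₀| |Real.log ((2 * R) ^ 2 + R + R)| with hLdef
  have hlog : ∀ᵐ p ∂(κ.prod κ),
      |Real.log (‖z p.1 - z p.2‖ ^ 2 + e p.1 + e p.2)| ≤ L := by
    have h1 := (Measure.quasiMeasurePreserving_fst (μ := κ) (ν := κ)).ae hzR
    have h2 := (Measure.quasiMeasurePreserving_snd (μ := κ) (ν := κ)).ae hzR
    filter_upwards [h1, h2] with p h1 h2
    have hlow : e₀ ≤ ‖z p.1 - z p.2‖ ^ 2 + e p.1 + e p.2 := by
      have h1 := hee p.1; have h2 := hep p.2; have h3 := sq_nonneg ‖z p.1 - z p.2‖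
      linarith
    have hup : ‖z p.1 - z p.2‖ ^ 2 + e p.1 + e p.2 ≤ (2 * R) ^ 2 + R + R := by
      have h4 : ‖z p.1 - z p.2‖ ≤ 2 * R := (norm_sub_le _ _).trans (by linarith)
      have := heR p.1; have := heR p.2
      gcongr
    rw [abs_le]
    constructor
    · have := Real.log_le_log he₀ hlow
      have h6 := neg_abs_le (Real.log e₀)
      have h7 := le_max_left |Real.log e₀| |Real.log ((2 * R) ^ 2 + R + R)|
      linarith
    · exact (Real.log_le_log (hw p) hup).trans ((le_abs_self _).trans (le_max_right _ _))
  have hbound : ∀ n : ℕ, ∀ᵐ p ∂(κ.prod κ), ‖q p.1 * q p.2 *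
      (((‖z p.1 - z p.2‖ ^ 2 + e p.1 + e p.2) ^ (-(1 / ((n : ℝ) + 1))) - 1)
        / (1 / ((n : ℝ) + 1)))‖ ≤ A * A * (L * Real.exp L) := by
    intro n
    filter_upwards [hlog] with p hp
    have hA0 : 0 ≤ A := (abs_nonneg _).trans (hA p.1)
    rw [norm_mul, norm_mul]
    simp only [Real.norm_eq_abs]
    refine mul_le_mul (mul_le_mul (hA _) (hA _) (abs_nonneg _) hA0) ?_ (abs_nonneg _)
      (by positivity)
    refine abs_rpow_neg_sub_one_div_le (hw p) hp (by positivity) ?_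
    rw [div_le_one (by positivity)]
    have : (0 : ℝ) ≤ n := n.cast_nonneg
    linarith
  have hlim := tendsto_integral_of_dominated_convergence (μ := κ.prod κ)
    (F := fun (n : ℕ) (p : Ω × Ω) => q p.1 * q p.2 *
      (((‖z p.1 - z p.2‖ ^ 2 + e p.1 + e p.2) ^ (-(1 / ((n : ℝ) + 1))) - 1)
        / (1 / ((n : ℝ) + 1))))
    (f := fun p => q p.1 * q p.2 * (-Real.log (‖z p.1 - z p.2‖ ^ 2 + e p.1 + e p.2)))
    (fun _ => A * A * (L * Real.exp L))
    (fun n => Measurable.aestronglyMeasurable (by fun_prop)) (integrable_const _) hbound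
    (Eventually.of_forall fun p => (tendsto_rpow_neg_sub_one_div (hw p)).const_mul _)
  refine ge_of_tendsto' hlim fun n => ?_
  have hδ : (0 : ℝ) < 1 / ((n : ℝ) + 1) := by positivity
  have h1 := rpow_posDef κ hz he hq hA he₀ hee hδ
  have hq0 : ∫ p : Ω × Ω, q p.1 * q p.2 ∂(κ.prod κ) = 0 := by
    rw [integral_prod_mul, hneutral, zero_mul]
  have hi1 : Integrable (fun p : Ω × Ω => q p.1 * q p.2) (κ.prod κ) := by
    refine Integrable.of_bound (C := A * A) (Measurable.aestronglyMeasurable (by fun_prop))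
      (Eventually.of_forall fun p => ?_)
    have hA0 : 0 ≤ A := (abs_nonneg _).trans (hA p.1)
    rw [norm_mul]
    exact mul_le_mul (hA _) (hA _) (abs_nonneg _) hA0
  have hi2 : Integrable (fun p : Ω × Ω => q p.1 * q p.2 *
      (‖z p.1 - z p.2‖ ^ 2 + e p.1 + e p.2) ^ (-(1 / ((n : ℝ) + 1)))) (κ.prod κ) := by
    refine Integrable.of_bound (C := A * A * e₀ ^ (-(1 / ((n : ℝ) + 1))))
      (Measurable.aestronglyMeasurable (by fun_prop)) (Eventually.of_forall fun p => ?_)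
    have hA0 : 0 ≤ A := (abs_nonneg _).trans (hA p.1)
    have := hw p
    rw [norm_mul, norm_mul]
    refine mul_le_mul (mul_le_mul (hA _) (hA _) (abs_nonneg _) hA0) ?_ (norm_nonneg _)
      (by positivity)
    rw [Real.norm_eq_abs, abs_of_nonneg (by positivity)]
    refine Real.rpow_le_rpow_of_nonpos he₀ ?_ (by linarith)
    have h1 := hee p.1; have h2 := hep p.2; have h3 := sq_nonneg ‖z p.1 - z p.2‖
    linarith
  have heq : ∀ p : Ω × Ω, q p.1 * q p.2 *
      (((‖z p.1 - z p.2‖ ^ 2 + e p.1 + e p.2) ^ (-(1 / ((n : ℝ) + 1))) - 1)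
        / (1 / ((n : ℝ) + 1))) = (1 / (1 / ((n : ℝ) + 1))) * (q p.1 * q p.2 *
      (‖z p.1 - z p.2‖ ^ 2 + e p.1 + e p.2) ^ (-(1 / ((n : ℝ) + 1))) - q p.1 * q p.2) := by
    intro p; ring
  simp_rw [heq, integral_const_mul]
  rw [integral_sub hi2 hi1, hq0, sub_zero]
  positivity

end

/-- `-log √w`. At `w = |x - y|² + τ` it is the logarithmic interaction of `x` and `y`, regularized at
length scale `√τ`. -/
def logKernel (w : ℝ) : ℝ := -(1 / 2) * Real.log w

@[fun_prop]
theorem measurable_logKernel : Measurable logKernel :=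
  Real.measurable_log.const_mul _

theorem logKernel_anti {v w : ℝ} (hv : 0 < v) (hvw : v ≤ w) : logKernel w ≤ logKernel v := by
  have := Real.log_le_log hv hvw
  simp only [logKernel]; linarith

/-- The kernel varies slowly: a shift of the argument by `s` costs at most `s / (2 v)`. -/
theorem logKernel_sub_le {v s : ℝ} (hv : 0 < v) (hs : 0 ≤ s) :
    logKernel v - logKernel (v + s) ≤ s / (2 * v) := by
  have h : Real.log (v + s) - Real.log v ≤ s / v := by
    rw [← Real.log_div (by positivity) hv.ne']
    refine (Real.log_le_sub_one_of_pos (by positivity)).trans (le_of_eq ?_)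
    field_simp; ring
  have h2 : s / (2 * v) = s / v / 2 := by field_simp
  simp only [logKernel]; rw [h2]; linarith

theorem abs_logKernel_le {e R w : ℝ} (he : 0 < e) (hew : e ≤ w) (hwR : w ≤ R) :
    |logKernel w| ≤ |logKernel e| + |logKernel R| := by
  have h1 := logKernel_anti he hew
  have h2 := logKernel_anti (he.trans_le hew) hwR
  have h3 := le_abs_self (logKernel e)
  have h4 := neg_abs_le (logKernel R)
  have h5 := abs_nonneg (logKernel e)
  have h6 := abs_nonneg (logKernel R)
  rw [abs_le]; constructor <;> linarith

/-- The regularized logarithmic energy of finitely many charge distributions `q i • κ i`, each smeared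
with its own parameter `e i`, is nonnegative if their total charge vanishes. -/
theorem sum_logKernel_nonneg {ι : Type*} [Fintype ι] (κ : ι → Measure Plane)
    [∀ i, IsFiniteMeasure (κ i)] {q : ι → Plane → ℝ} (hq : ∀ i, Measurable (q i)) {A : ℝ}
    (hA : ∀ i x, |q i x| ≤ A) {e : ι → ℝ} (he : ∀ i, 0 < e i) {R : ℝ}
    (hR : ∀ i, ∀ᵐ x ∂κ i, ‖x‖ ≤ R) (hneutral : ∑ i, ∫ x, q i x ∂κ i = 0) :
    0 ≤ ∑ i, ∑ j, ∫ x, ∫ y, q i x * q j y * logKernel (‖x - y‖ ^ 2 + e i + e j) ∂κ j ∂κ i := by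
  classical
  cases isEmpty_or_nonempty ι
  · simp
  obtain ⟨i₀, hi₀⟩ := Finite.exists_min e
  obtain ⟨i₁, hi₁⟩ := Finite.exists_max e
  let _ : MeasurableSpace ι := ⊤
  have hA0 : 0 ≤ A := (abs_nonneg _).trans (hA i₀ 0)
  set ρ : Measure (ι × Plane) := ∑ i, (κ i).map (Prod.mk i) with hρ
  have hmk : ∀ i : ι, Measurable (Prod.mk i : Plane → ι × Plane) := fun i => measurable_prodMk_left
  have hfin : IsFiniteMeasure ρ := by rw [hρ]; infer_instance
  have hqm : Measurable (fun p : ι × Plane => q p.1 p.2) :=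
    measurable_from_prod_countable_right fun i => hq i
  have hem : Measurable (fun p : ι × Plane => e p.1) :=
    (measurable_from_top (f := e)).comp measurable_fst
  have hle : ∀ i, (κ i).map (Prod.mk i) ≤ ρ := fun i => by
    rw [hρ]; exact Finset.single_le_sum (f := fun i => (κ i).map (Prod.mk i))
      (fun _ _ => Measure.zero_le _) (Finset.mem_univ i)
  have hint : ∀ f : ι × Plane → ℝ, Measurable f → Integrable f ρ →
      ∫ p, f p ∂ρ = ∑ i, ∫ x, f (i, x) ∂κ i := by
    intro f hf hfi
    rw [hρ, integral_finsetSum_measure]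
    · refine Finset.sum_congr rfl fun i _ => ?_
      rw [integral_map (hmk i).aemeasurable hf.aestronglyMeasurable]
    · intro i _
      exact hfi.mono_measure (hle i)
  have hRρ : ∀ᵐ p ∂ρ, ‖p.2‖ ≤ max R (e i₁) := by
    rw [hρ, ← Measure.sum_fintype, Measure.ae_sum_iff]
    intro i
    rw [ae_map_iff (hmk i).aemeasurable (measurableSet_le (by fun_prop) (by fun_prop))]
    filter_upwards [hR i] with x hx
    exact hx.trans (le_max_left _ _)
  have hn : ∫ p, q p.1 p.2 ∂ρ = 0 := by
    rw [hint _ hqm, hneutral]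
    exact Integrable.of_bound (C := A) hqm.aestronglyMeasurable
      (Eventually.of_forall fun p => hA _ _)
  have key := neg_log_condPosDef ρ (z := Prod.snd) measurable_snd hem hqm (fun p => hA p.1 p.2)
    (he i₀) (fun p => hi₀ p.1) (R := max R (e i₁))
    (fun p => (hi₁ p.1).trans (le_max_right _ _)) hRρ hn
  set f : (ι × Plane) × (ι × Plane) → ℝ := fun p => q p.1.1 p.1.2 * q p.2.1 p.2.2 *
      (-Real.log (‖p.1.2 - p.2.2‖ ^ 2 + e p.1.1 + e p.2.1)) with hf
  have hfm : Measurable f := by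
    have h1 : Measurable fun p : (ι × Plane) × (ι × Plane) => q p.1.1 p.1.2 :=
      hqm.comp measurable_fst
    have h2 : Measurable fun p : (ι × Plane) × (ι × Plane) => q p.2.1 p.2.2 :=
      hqm.comp measurable_snd
    have h3 : Measurable fun p : (ι × Plane) × (ι × Plane) => e p.1.1 :=
      hem.comp measurable_fst
    have h4 : Measurable fun p : (ι × Plane) × (ι × Plane) => e p.2.1 :=
      hem.comp measurable_snd
    simp only [hf]; fun_prop
  set R' := max R (e i₁) with hR'
  have hfb : ∀ᵐ p ∂(ρ.prod ρ), ‖f p‖ ≤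
      A * A * (2 * (|logKernel (e i₀)| + |logKernel ((2 * R') ^ 2 + R' + R')|)) := by
    have h1 := (Measure.quasiMeasurePreserving_fst (μ := ρ) (ν := ρ)).ae hRρ
    have h2 := (Measure.quasiMeasurePreserving_snd (μ := ρ) (ν := ρ)).ae hRρ
    filter_upwards [h1, h2] with p h1 h2
    simp only [hf, norm_mul, Real.norm_eq_abs]
    refine mul_le_mul (mul_le_mul (hA _ _) (hA _ _) (abs_nonneg _) hA0) ?_ (abs_nonneg _)
      (by positivity)
    have h3 : -Real.log (‖p.1.2 - p.2.2‖ ^ 2 + e p.1.1 + e p.2.1)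
        = 2 * logKernel (‖p.1.2 - p.2.2‖ ^ 2 + e p.1.1 + e p.2.1) := by
      simp only [logKernel]; ring
    rw [h3, abs_mul, abs_of_pos (two_pos (α := ℝ))]
    refine mul_le_mul_of_nonneg_left (abs_logKernel_le (he i₀) ?_ ?_) zero_le_two
    · have := hi₀ p.1.1; have := he p.2.1; have := sq_nonneg ‖p.1.2 - p.2.2‖
      linarith
    · have h4 : ‖p.1.2 - p.2.2‖ ≤ 2 * R' := (norm_sub_le _ _).trans (by linarith)
      have := hi₁ p.1.1; have := hi₁ p.2.1; have := le_max_right R (e i₁)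
      have : ‖p.1.2 - p.2.2‖ ^ 2 ≤ (2 * R') ^ 2 := by gcongr
      linarith
  have hfi : Integrable f (ρ.prod ρ) := Integrable.of_bound hfm.aestronglyMeasurable _ hfb
  rw [integral_prod f hfi] at key
  rw [hint _ hfm.stronglyMeasurable.integral_prod_right.measurable hfi.integral_prod_left] at key
  have hsec := ((integrable_prod_iff hfm.aestronglyMeasurable).1 hfi).1
  have hsec' : ∀ i, ∀ᵐ x ∂κ i, Integrable (fun p => f ((i, x), p)) ρ := by
    intro i
    exact ae_of_ae_map (hmk i).aemeasurable (ae_mono (hle i) hsec)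
  have h2 : ∀ i, ∫ x, ∫ p, f ((i, x), p) ∂ρ ∂κ i
      = 2 * ∑ j, ∫ x, ∫ y, q i x * q j y * logKernel (‖x - y‖ ^ 2 + e i + e j) ∂κ j ∂κ i := by
    intro i
    have h3 : ∀ᵐ x ∂κ i, ∫ p, f ((i, x), p) ∂ρ = ∑ j, ∫ y, f ((i, x), (j, y)) ∂κ j := by
      filter_upwards [hsec' i] with x hx
      exact hint _ (hfm.comp measurable_prodMk_left) hx
    rw [integral_congr_ae h3, integral_finsetSum, Finset.mul_sum]
    · refine Finset.sum_congr rfl fun j _ => ?_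
      rw [← integral_const_mul]
      refine integral_congr_ae (Eventually.of_forall fun x => ?_)
      simp only
      rw [← integral_const_mul]
      refine integral_congr_ae (Eventually.of_forall fun y => ?_)
      simp only [hf, logKernel]; ring
    · intro j _
      have h4 : Integrable f (((κ i).map (Prod.mk i)).prod ((κ j).map (Prod.mk j))) :=
        hfi.mono_measure (Measure.prod_mono (hle i) (hle j))
      have h5 := h4.integral_prod_left
      rw [integrable_map_measure h5.aestronglyMeasurable (hmk i).aemeasurable] at h5
      refine h5.congr (Eventually.of_forall fun x => ?_)
      simp only [Function.comp]
      have hm : Measurable fun p => f ((i, x), p) := hfm.comp measurable_prodMk_left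
      rw [integral_map (hmk j).aemeasurable hm.aestronglyMeasurable]
  simp only [h2] at key
  rw [← Finset.mul_sum] at key
  exact (mul_nonneg_iff_of_pos_left two_pos).1 key

/-! ### The energy dominates the regularized energy -/

/-- The logarithmic potential of `μ`, regularized at length scale `√τ`. -/
def logPotential (μ : Measure Square) (τ : ℝ) (z : Plane) : ℝ :=
  ∫ y : Square, logKernel (‖z - y.1‖ ^ 2 + τ) ∂μ

/-- The regularized potential of the neutral charge `μ - ν`. -/
def chargePotential (μ ν : Measure Square) (τ : ℝ) (z : Plane) : ℝ :=
  logPotential μ τ z - logPotential ν τ z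

/-- The regularized logarithmic self-energy of the neutral charge `μ - ν`. -/
def chargeEnergy (μ ν : Measure Square) (τ : ℝ) : ℝ :=
  ∫ x : Square, chargePotential μ ν τ x.1 ∂μ - ∫ x : Square, chargePotential μ ν τ x.1 ∂ν

theorem norm_sub_sq_le_two (x y : Square) : ‖x.1 - y.1‖ ^ 2 ≤ 2 := by
  have hx := x.2
  have hy := y.2
  simp only [squareSet, Set.mem_ofPred_eq, Set.mem_Icc] at hx hy
  rw [EuclideanSpace.norm_sq_eq, Fin.sum_univ_two]
  simp only [PiLp.sub_apply, Real.norm_eq_abs, sq_abs]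
  have h0 := hx 0; have h1 := hx 1; have h2 := hy 0; have h3 := hy 1
  nlinarith

theorem norm_le_two (x : Square) : ‖x.1‖ ≤ 2 := by
  have hx := x.2
  simp only [squareSet, Set.mem_ofPred_eq, Set.mem_Icc] at hx
  have h : ‖x.1‖ ^ 2 ≤ 2 := by
    rw [EuclideanSpace.norm_sq_eq, Fin.sum_univ_two]
    simp only [Real.norm_eq_abs, sq_abs]
    have h0 := hx 0; have h1 := hx 1
    nlinarith
  nlinarith [norm_nonneg x.1]

theorem measurable_logKernel_norm_sub (τ : ℝ) :
    Measurable fun p : Plane × Square => logKernel (‖p.1 - p.2.1‖ ^ 2 + τ) := by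
  fun_prop

theorem integrable_logKernel (μ : Measure Square) [IsFiniteMeasure μ] {τ : ℝ} (hτ : 0 < τ)
    (z : Plane) : Integrable (fun y : Square => logKernel (‖z - y.1‖ ^ 2 + τ)) μ := by
  refine Integrable.of_bound (C := |logKernel τ| + |logKernel ((‖z‖ + 2) ^ 2 + τ)|)
    (Measurable.aestronglyMeasurable (by fun_prop)) (Eventually.of_forall fun y => ?_)
  refine abs_logKernel_le hτ (by nlinarith [sq_nonneg ‖z - y.1‖]) ?_
  have : ‖z - y.1‖ ≤ ‖z‖ + 2 := (norm_sub_le _ _).trans (by linarith [norm_le_two y])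
  gcongr

theorem measurable_logPotential (μ : Measure Square) [IsFiniteMeasure μ] (τ : ℝ) :
    Measurable (logPotential μ τ) :=
  ((measurable_logKernel_norm_sub τ).stronglyMeasurable.integral_prod_right
    (ν := μ)).measurable

theorem abs_logPotential_le (μ : Measure Square) [IsProbabilityMeasure μ] {τ : ℝ} (hτ : 0 < τ)
    (x : Square) : |logPotential μ τ x.1| ≤ |logKernel τ| + |logKernel (2 + τ)| := by
  have h := norm_integral_le_of_norm_le_const (μ := μ)
    (f := fun y : Square => logKernel (‖x.1 - y.1‖ ^ 2 + τ))
    (C := |logKernel τ| + |logKernel (2 + τ)|) (Eventually.of_forall fun y =>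
      abs_logKernel_le hτ (by nlinarith [sq_nonneg ‖x.1 - y.1‖])
        (by linarith [norm_sub_sq_le_two x y]))
  simpa [logPotential] using h

theorem integrable_logPotential (μ ν : Measure Square) [IsProbabilityMeasure μ]
    [IsFiniteMeasure ν] {τ : ℝ} (hτ : 0 < τ) :
    Integrable (fun x : Square => logPotential μ τ x.1) ν :=
  Integrable.of_bound
    ((measurable_logPotential μ τ).comp measurable_subtype_coe).aestronglyMeasurable _
    (Eventually.of_forall fun x => abs_logPotential_le μ hτ x)

/-- Increasing the regularization of the potential of `μ - ν` from `τ` to `τ + s` changes it by at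
most `s / (2 τ)`. -/
theorem abs_chargePotential_sub_le (μ ν : Measure Square) [IsProbabilityMeasure μ]
    [IsProbabilityMeasure ν] {τ s : ℝ} (hτ : 0 < τ) (hs : 0 ≤ s) (z : Plane) :
    |chargePotential μ ν τ z - chargePotential μ ν (τ + s) z| ≤ s / (2 * τ) := by
  have h : ∀ (ρ : Measure Square) [IsProbabilityMeasure ρ],
      0 ≤ logPotential ρ τ z - logPotential ρ (τ + s) z ∧
      logPotential ρ τ z - logPotential ρ (τ + s) z ≤ s / (2 * τ) := by
    intro ρ _
    have hi := integrable_logKernel ρ hτ z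
    have hi' := integrable_logKernel ρ (add_pos_of_pos_of_nonneg hτ hs) z
    rw [logPotential, logPotential, ← integral_sub hi hi']
    constructor
    · refine integral_nonneg fun y => ?_
      simp only [Pi.zero_apply, sub_nonneg]
      exact logKernel_anti (by positivity) (by linarith)
    · have : ∫ _ : Square, s / (2 * τ) ∂ρ = s / (2 * τ) := by simp
      rw [← this]
      refine integral_mono (hi.sub hi') (integrable_const _) fun y => ?_
      have h1 : 0 < ‖z - y.1‖ ^ 2 + τ := by positivity
      have h2 := logKernel_sub_le h1 hs
      simp only
      rw [add_assoc] at h2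
      refine h2.trans ?_
      have := sq_nonneg ‖z - y.1‖
      gcongr
      linarith
  obtain ⟨a1, a2⟩ := h μ
  obtain ⟨b1, b2⟩ := h ν
  simp only [chargePotential]
  rw [abs_le]
  constructor <;> linarith

theorem integral_map_logKernel (μ : Measure Square) (τ : ℝ) (z : Plane) (c : ℝ) :
    ∫ y, c * logKernel (‖z - y‖ ^ 2 + τ) ∂(μ.map Subtype.val) = c * logPotential μ τ z := by
  rw [integral_map measurable_subtype_coe.aemeasurable
    (Measurable.aestronglyMeasurable (by fun_prop)), integral_const_mul, logPotential]

/-- Positivity of the energy of a system of smeared point charges `s a` at `z a`, together with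
`-c` times the smeared charge `μ - ν`. -/
theorem pointCharges_energy_nonneg {α : Type*} [Fintype α] (μ ν : Measure Square)
    [IsProbabilityMeasure μ] [IsProbabilityMeasure ν] (z : α → Square) (s e : α → ℝ)
    (he : ∀ a, 0 < e a) (hs : ∑ a, s a = 0) {τ : ℝ} (hτ : 0 < τ) (c : ℝ) :
    0 ≤ ∑ a, ∑ b, s a * s b * logKernel (‖(z a).1 - (z b).1‖ ^ 2 + e a + e b)
      - 2 * c * ∑ a, s a * chargePotential μ ν (τ + e a) (z a).1
      + c ^ 2 * chargeEnergy μ ν (τ + τ) := by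
  let κ : α ⊕ Bool → Measure Plane := Sum.elim (fun a => Measure.dirac (z a).1)
    (fun b => if b then μ.map Subtype.val else ν.map Subtype.val)
  let q : α ⊕ Bool → ℝ := Sum.elim s (fun b => if b then -c else c)
  let d : α ⊕ Bool → ℝ := Sum.elim e (fun _ => τ)
  have hmp : IsProbabilityMeasure (μ.map (Subtype.val : Square → Plane)) :=
    Measure.isProbabilityMeasure_map measurable_subtype_coe.aemeasurable
  have hmm : IsProbabilityMeasure (ν.map (Subtype.val : Square → Plane)) :=
    Measure.isProbabilityMeasure_map measurable_subtype_coe.aemeasurable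
  have hκ : ∀ i, IsProbabilityMeasure (κ i) := by
    rintro (a | b)
    · simp only [κ, Sum.elim_inl]; infer_instance
    · cases b
      · simpa [κ] using hmm
      · simpa [κ] using hmp
  have hset : MeasurableSet {x : Plane | ‖x‖ ≤ 2} :=
    measurableSet_le (by fun_prop) (by fun_prop)
  have hR : ∀ i, ∀ᵐ x ∂κ i, ‖x‖ ≤ 2 := by
    rintro (a | b)
    · simp only [κ, Sum.elim_inl]
      rw [ae_dirac_iff hset]; exact norm_le_two _
    · cases b
      · simp only [κ, Sum.elim_inr, Bool.false_eq_true, if_false]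
        rw [ae_map_iff measurable_subtype_coe.aemeasurable hset]
        exact Eventually.of_forall norm_le_two
      · simp only [κ, Sum.elim_inr, if_true]
        rw [ae_map_iff measurable_subtype_coe.aemeasurable hset]
        exact Eventually.of_forall norm_le_two
  have hd : ∀ i, 0 < d i := by
    rintro (a | b)
    · exact he a
    · exact hτ
  obtain ⟨A, hA⟩ : ∃ A, ∀ i, |q i| ≤ A := by
    obtain ⟨A, hA⟩ := (Set.finite_range fun i => |q i|).bddAbove
    exact ⟨A, fun i => hA ⟨i, rfl⟩⟩
  have hn : ∑ i, ∫ _, q i ∂κ i = 0 := by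
    have : ∀ i, ∫ _, q i ∂κ i = q i := fun i => by simp
    simp only [this, Fintype.sum_sum_type, Fintype.sum_bool, q, Sum.elim_inl, Sum.elim_inr, hs]
    simp
  have key := sum_logKernel_nonneg κ (q := fun i _ => q i) (fun i => measurable_const)
    (fun i _ => hA i) hd hR hn
  have hU : ∀ (ρ : Measure Square) [IsProbabilityMeasure ρ] (σ : Measure Square) (k t : ℝ),
      ∫ x, k * logPotential ρ t x ∂(σ.map Subtype.val)
        = k * ∫ x : Square, logPotential ρ t x.1 ∂σ := by
    intro ρ _ σ k t
    rw [integral_map measurable_subtype_coe.aemeasurable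
      ((measurable_logPotential ρ t).const_mul k).aestronglyMeasurable, integral_const_mul]
  have hsw : ∀ (ρ : Measure Square) (k : ℝ) (a : α),
      ∫ x, k * logKernel (‖x - (z a).1‖ ^ 2 + (τ + e a)) ∂(ρ.map Subtype.val)
        = k * logPotential ρ (τ + e a) (z a).1 := by
    intro ρ k a
    simp_rw [norm_sub_rev _ (z a).1]
    exact integral_map_logKernel ρ (τ + e a) (z a).1 k
  simp only [Fintype.sum_sum_type, Fintype.sum_bool, κ, q, d, Sum.elim_inl, Sum.elim_inr, if_true,
    Bool.false_eq_true, if_false, integral_dirac, add_assoc, integral_map_logKernel, hsw, hU] at key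
  refine key.trans (le_of_eq ?_)
  have hE : chargeEnergy μ ν (τ + τ) = (∫ x : Square, logPotential μ (τ + τ) x.1 ∂μ
      - ∫ x : Square, logPotential ν (τ + τ) x.1 ∂μ)
      - (∫ x : Square, logPotential μ (τ + τ) x.1 ∂ν
        - ∫ x : Square, logPotential ν (τ + τ) x.1 ∂ν) := by
    simp only [chargeEnergy, chargePotential]
    rw [integral_sub (integrable_logPotential μ μ (by positivity))
      (integrable_logPotential ν μ (by positivity)),
      integral_sub (integrable_logPotential μ ν (by positivity))
      (integrable_logPotential ν ν (by positivity))]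
  rw [hE]
  simp only [chargePotential, mul_sub, Finset.sum_sub_distrib, Finset.sum_add_distrib,
    Finset.mul_sum, add_assoc, add_comm (e _) τ]
  have e1 : ∀ (ρ : Measure Square), ∑ a, s a * -c * logPotential ρ (τ + e a) (z a).1
      = -(c * ∑ a, s a * logPotential ρ (τ + e a) (z a).1) := by
    intro ρ; rw [Finset.mul_sum, ← Finset.sum_neg_distrib]
    exact Finset.sum_congr rfl fun a _ => by ring
  have e2 : ∀ (ρ : Measure Square), ∑ a, s a * c * logPotential ρ (τ + e a) (z a).1
      = c * ∑ a, s a * logPotential ρ (τ + e a) (z a).1 := by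
    intro ρ; rw [Finset.mul_sum]
    exact Finset.sum_congr rfl fun a _ => by ring
  have e3 : ∀ (ρ : Measure Square), ∑ a, -c * s a * logPotential ρ (τ + e a) (z a).1
      = -(c * ∑ a, s a * logPotential ρ (τ + e a) (z a).1) := by
    intro ρ; rw [Finset.mul_sum, ← Finset.sum_neg_distrib]
    exact Finset.sum_congr rfl fun a _ => by ring
  have e4 : ∀ (ρ : Measure Square), ∑ a, c * s a * logPotential ρ (τ + e a) (z a).1
      = c * ∑ a, s a * logPotential ρ (τ + e a) (z a).1 := by
    intro ρ; rw [Finset.mul_sum]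
    exact Finset.sum_congr rfl fun a _ => by ring
  have e5 : ∀ (ρ : Measure Square), ∑ a, 2 * c * (s a * logPotential ρ (τ + e a) (z a).1)
      = 2 * c * ∑ a, s a * logPotential ρ (τ + e a) (z a).1 := by
    intro ρ; rw [Finset.mul_sum]
  rw [e1, e2, e3, e4, e5, e5]
  ring

/-- The energy bound at the heart of the argument. Every charge is smeared at a scale proportional to
a lower bound `r` for its distance to the charges of the opposite sign; like charges only lose energy
in this way, opposite ones gain at most `η` per pair, and the self-energies of the smeared charges
only cost the `2 N` terms `log r`. -/
theorem energy_ge {N : ℕ} (hN : 1 ≤ N) (μ ν : Measure Square) [IsProbabilityMeasure μ]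
    [IsProbabilityMeasure ν] (c : Config N) (hx : ∀ i j, i ≠ j → c.1 i ≠ c.1 j)
    (hy : ∀ i j, i ≠ j → c.2 i ≠ c.2 j) {r r' : Fin N → ℝ} (hr : ∀ i, 0 < r i)
    (hr' : ∀ j, 0 < r' j) (hrd : ∀ i j, r i ≤ dist (c.1 i) (c.2 j))
    (hrd' : ∀ i j, r' j ≤ dist (c.1 i) (c.2 j)) {τ η : ℝ} (hτ : 0 < τ) (hη : 0 < η) :
    2 * N * (∑ i, chargePotential μ ν τ (c.1 i).1 - ∑ j, chargePotential μ ν τ (c.2 j).1)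
      - N ^ 2 * (chargeEnergy μ ν (τ + τ) + 4 * η / τ + 2 * η)
      - 2 * N * logKernel (2 * η) + ∑ i, Real.log (r i) + ∑ j, Real.log (r' j) ≤ energy c := by
  have hN0 : 0 < N := hN
  let j₀ : Fin N := ⟨0, hN0⟩
  have hd : ∀ x y : Square, dist x y = ‖x.1 - y.1‖ := fun x y => by
    rw [Subtype.dist_eq, dist_eq_norm]
  have hg : ∀ x y : Square, -Real.log (dist x y) = logKernel (‖x.1 - y.1‖ ^ 2) := by
    intro x y
    rw [hd, logKernel, Real.log_pow]; push_cast; ring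
  have hr2 : ∀ i, r i ^ 2 ≤ 2 := fun i => by
    have h1 := hrd i j₀
    rw [hd] at h1
    calc r i ^ 2 ≤ ‖(c.1 i).1 - (c.2 j₀).1‖ ^ 2 := by gcongr; exact (hr i).le
      _ ≤ 2 := norm_sub_sq_le_two _ _
  have hr2' : ∀ j, r' j ^ 2 ≤ 2 := fun j => by
    have h1 := hrd' j₀ j
    rw [hd] at h1
    calc r' j ^ 2 ≤ ‖(c.1 j₀).1 - (c.2 j).1‖ ^ 2 := by gcongr; exact (hr' j).le
      _ ≤ 2 := norm_sub_sq_le_two _ _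
  let z : Fin N ⊕ Fin N → Square := Sum.elim c.1 c.2
  let s : Fin N ⊕ Fin N → ℝ := Sum.elim (fun _ => 1) (fun _ => -1)
  let e : Fin N ⊕ Fin N → ℝ := Sum.elim (fun i => η * r i ^ 2) (fun j => η * r' j ^ 2)
  have he : ∀ a, 0 < e a := by
    rintro (i | j)
    · have := hr i
      simp only [e, Sum.elim_inl]; positivity
    · have := hr' j
      simp only [e, Sum.elim_inr]; positivity
  have he2 : ∀ a, e a ≤ 2 * η := by
    rintro (i | j)
    · simp only [e, Sum.elim_inl]; nlinarith [hr2 i]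
    · simp only [e, Sum.elim_inr]; nlinarith [hr2' j]
  have key := pointCharges_energy_nonneg μ ν z s e he (by simp [s]) hτ N
  have hpot : ∑ a, s a * chargePotential μ ν τ (z a).1 - 2 * N * (η / τ)
      ≤ ∑ a, s a * chargePotential μ ν (τ + e a) (z a).1 := by
    have h1 : ∀ a, s a * chargePotential μ ν τ (z a).1 - η / τ
        ≤ s a * chargePotential μ ν (τ + e a) (z a).1 := by
      intro a
      have h2 := abs_le.1 (abs_chargePotential_sub_le μ ν hτ (he a).le (z a).1)
      have h3 : e a / (2 * τ) ≤ η / τ := by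
        rw [div_le_div_iff₀ (by positivity) hτ]
        nlinarith [he2 a]
      rcases a with i | j
      · simp only [s, Sum.elim_inl] at h2 ⊢; linarith
      · simp only [s, Sum.elim_inr] at h2 ⊢; linarith
    have h4 := Finset.sum_le_sum fun a (_ : a ∈ Finset.univ) => h1 a
    rw [Finset.sum_sub_distrib, Finset.sum_const, Finset.card_univ, Fintype.card_sum,
      Fintype.card_fin, nsmul_eq_mul] at h4
    push_cast at h4
    linarith
  have hsum : ∑ a, s a * chargePotential μ ν τ (z a).1
      = ∑ i, chargePotential μ ν τ (c.1 i).1 - ∑ j, chargePotential μ ν τ (c.2 j).1 := by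
    simp [Fintype.sum_sum_type, s, z, sub_eq_add_neg]
  rw [hsum] at hpot
  have hdiag : ∀ t : ℝ, 0 < t → logKernel (η * t ^ 2 + η * t ^ 2)
      = logKernel (2 * η) - Real.log t := by
    intro t ht
    have : η * t ^ 2 + η * t ^ 2 = (2 * η) * t ^ 2 := by ring
    rw [this, logKernel, logKernel, Real.log_mul (by positivity) (by positivity), Real.log_pow]
    push_cast; ring
  have hlike : ∀ (x : Fin N → Square) (t : Fin N → ℝ), (∀ i j, i ≠ j → x i ≠ x j) →
      (∀ i, 0 < t i) → ∑ i, ∑ j, logKernel (‖(x i).1 - (x j).1‖ ^ 2 + η * t i ^ 2 + η * t j ^ 2)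
        ≤ (∑ i, ∑ j, if i ≠ j then -Real.log (dist (x i) (x j)) else 0)
          + (N * logKernel (2 * η) - ∑ i, Real.log (t i)) := by
    intro x t hxx ht
    have h1 : (N * logKernel (2 * η) - ∑ i, Real.log (t i))
        = ∑ i, ∑ j, if i = j then logKernel (2 * η) - Real.log (t i) else 0 := by
      simp [Finset.sum_sub_distrib]
    rw [h1, ← Finset.sum_add_distrib]
    refine Finset.sum_le_sum fun i _ => ?_
    rw [← Finset.sum_add_distrib]
    refine Finset.sum_le_sum fun j _ => ?_
    by_cases hij : i = j
    · subst hij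
      simp only [sub_self, norm_zero, ne_eq, not_true_eq_false, if_false, if_true, zero_add]
      rw [zero_pow two_ne_zero, zero_add, hdiag _ (ht i)]
    · simp only [ne_eq, hij, not_false_eq_true, if_true, if_false, add_zero]
      rw [hg]
      have h2 : 0 < ‖(x i).1 - (x j).1‖ := by
        rw [norm_pos_iff, sub_ne_zero]
        exact fun h => hxx i j hij (Subtype.ext h)
      have := ht i; have := ht j
      refine logKernel_anti (by positivity) ?_
      have : 0 < η * t i ^ 2 := by positivity
      have : 0 < η * t j ^ 2 := by positivity
      linarith
  have hcross : ∀ i j, -Real.log (dist (c.1 i) (c.2 j)) - η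
      ≤ logKernel (‖(c.1 i).1 - (c.2 j).1‖ ^ 2 + η * r i ^ 2 + η * r' j ^ 2) := by
    intro i j
    have h1 := hrd i j
    have h2 := hrd' i j
    rw [hd] at h1 h2
    set ρ := ‖(c.1 i).1 - (c.2 j).1‖ with hρ
    have hρ0 : 0 < ρ := (hr i).trans_le h1
    have h3 : r i ^ 2 ≤ ρ ^ 2 := by gcongr; exact (hr i).le
    have h4 : r' j ^ 2 ≤ ρ ^ 2 := by gcongr; exact (hr' j).le
    have h5 := logKernel_sub_le (v := ρ ^ 2) (s := η * r i ^ 2 + η * r' j ^ 2) (by positivity)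
      (by positivity)
    have h6 : (η * r i ^ 2 + η * r' j ^ 2) / (2 * ρ ^ 2) ≤ η := by
      rw [div_le_iff₀ (by positivity)]
      nlinarith
    rw [hg, add_assoc]
    linarith
  have hcross' := Finset.sum_le_sum fun i (_ : i ∈ Finset.univ) =>
    Finset.sum_le_sum fun j (_ : j ∈ Finset.univ) => hcross i j
  simp only [Finset.sum_sub_distrib, Finset.sum_neg_distrib, Finset.sum_const, Finset.card_univ,
    Fintype.card_fin, nsmul_eq_mul] at hcross'
  have hx' := hlike c.1 r hx hr
  have hy' := hlike c.2 r' hy hr'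
  have hen : energy c = (∑ i, ∑ j, if i ≠ j then -Real.log (dist (c.1 i) (c.1 j)) else 0)
      + (∑ i, ∑ j, if i ≠ j then -Real.log (dist (c.2 i) (c.2 j)) else 0)
      + 2 * ∑ i, ∑ j, Real.log (dist (c.1 i) (c.2 j)) := by
    rw [energy, ← Finset.sum_add_distrib]
    congr 1
    refine Finset.sum_congr rfl fun i _ => ?_
    rw [← Finset.sum_add_distrib]
    refine Finset.sum_congr rfl fun j _ => ?_
    split_ifs <;> ring
  have hexp : ∑ a, ∑ b, s a * s b * logKernel (‖(z a).1 - (z b).1‖ ^ 2 + e a + e b)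
      = ∑ i, ∑ j, logKernel (‖(c.1 i).1 - (c.1 j).1‖ ^ 2 + η * r i ^ 2 + η * r j ^ 2)
      + ∑ i, ∑ j, logKernel (‖(c.2 i).1 - (c.2 j).1‖ ^ 2 + η * r' i ^ 2 + η * r' j ^ 2)
      - 2 * ∑ i, ∑ j, logKernel (‖(c.1 i).1 - (c.2 j).1‖ ^ 2 + η * r i ^ 2 + η * r' j ^ 2) := by
    have hsym : ∑ i, ∑ j, logKernel (‖(c.2 i).1 - (c.1 j).1‖ ^ 2 + η * r' i ^ 2 + η * r j ^ 2)
        = ∑ i, ∑ j, logKernel (‖(c.1 i).1 - (c.2 j).1‖ ^ 2 + η * r i ^ 2 + η * r' j ^ 2) := by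
      rw [Finset.sum_comm]
      refine Finset.sum_congr rfl fun i _ => Finset.sum_congr rfl fun j _ => ?_
      rw [norm_sub_rev, add_right_comm]
    simp only [Fintype.sum_sum_type, s, z, e, Sum.elim_inl, Sum.elim_inr, one_mul, mul_one,
      neg_mul, mul_neg, Finset.sum_add_distrib, Finset.sum_neg_distrib, hsym]
    ring
  rw [hexp] at key
  rw [hen]
  have hNpos : (0 : ℝ) < N := by exact_mod_cast hN0
  have hpot' := mul_le_mul_of_nonneg_left hpot (by positivity : (0 : ℝ) ≤ 2 * N)
  have h7 : 2 * (N : ℝ) * (2 * N * (η / τ)) = N ^ 2 * (4 * η / τ) := by ring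
  nlinarith

/-! ### Lebesgue measure on configurations -/

theorem measurableSet_squareSet : MeasurableSet squareSet := by
  have : squareSet = ⋂ k, {x : Plane | x k ∈ Set.Icc (0 : ℝ) 1} := by
    ext x; simp [squareSet]
  rw [this]
  exact MeasurableSet.iInter fun k => measurableSet_Icc.preimage (by fun_prop)

theorem measurableEmbedding_val : MeasurableEmbedding (Subtype.val : Square → Plane) :=
  MeasurableEmbedding.subtype_coe measurableSet_squareSet

instance isProbabilityMeasure_lebSquare : IsProbabilityMeasure lebSquare := by
  constructor
  rw [lebSquare, measurableEmbedding_val.comap_apply, Set.image_univ, Subtype.range_coe]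
  have h := (PiLp.volume_preserving_ofLp (Fin 2)).measure_preimage
    (s := Set.Icc (0 : Fin 2 → ℝ) 1) measurableSet_Icc.nullMeasurableSet
  have h2 : (WithLp.ofLp : Plane → Fin 2 → ℝ) ⁻¹' Set.Icc (0 : Fin 2 → ℝ) 1 = squareSet := by
    ext x; simp [squareSet, Pi.le_def, forall_and]
  rw [h2, Real.volume_Icc_pi] at h
  simpa using h

instance nullSingletonClass_lebSquare : NullSingletonClass lebSquare := by
  constructor
  intro x
  rw [lebSquare, measurableEmbedding_val.comap_apply, Set.image_singleton, measure_singleton]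

instance isProbabilityMeasure_lebConfig (N : ℕ) : IsProbabilityMeasure (lebConfig N) := by
  unfold lebConfig; infer_instance

theorem measurePreserving_pair_fst {N : ℕ} {i j : Fin N} (hij : i ≠ j) :
    MeasurePreserving (fun c : Config N => (c.1 i, c.1 j)) (lebConfig N)
      (lebSquare.prod lebSquare) := by
  have h : MeasurePreserving (fun x : Fin N → Square => (x i, x j))
      (Measure.pi fun _ => lebSquare) (lebSquare.prod lebSquare) := by
    refine ⟨by fun_prop, ?_⟩
    have hi := (ProbabilityTheory.iIndepFun_pi (μ := fun _ : Fin N => lebSquare)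
      (X := fun _ x => x) (fun _ => aemeasurable_id)).indepFun hij
    rw [(ProbabilityTheory.indepFun_iff_map_prod_eq_prod_map_map
      (measurable_pi_apply i).aemeasurable (measurable_pi_apply j).aemeasurable).1 hi]
    exact congrArg₂ _ (measurePreserving_eval (fun _ : Fin N => lebSquare) i).map_eq
      (measurePreserving_eval (fun _ : Fin N => lebSquare) j).map_eq
  exact h.comp measurePreserving_fst

theorem measurePreserving_pair_snd {N : ℕ} {i j : Fin N} (hij : i ≠ j) :
    MeasurePreserving (fun c : Config N => (c.2 i, c.2 j)) (lebConfig N)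
      (lebSquare.prod lebSquare) :=
  (measurePreserving_pair_fst hij).comp (g := fun c : Config N => (c.1 i, c.1 j))
    (Measure.measurePreserving_swap (μ := Measure.pi fun _ : Fin N => lebSquare)
      (ν := Measure.pi fun _ : Fin N => lebSquare))

theorem measurePreserving_pair_cross {N : ℕ} (i j : Fin N) :
    MeasurePreserving (fun c : Config N => (c.1 i, c.2 j)) (lebConfig N)
      (lebSquare.prod lebSquare) :=
  (measurePreserving_eval (fun _ : Fin N => lebSquare) i).prod
    (measurePreserving_eval (fun _ : Fin N => lebSquare) j)

theorem ae_fst_ne_snd : ∀ᵐ p ∂(lebSquare.prod lebSquare), p.1 ≠ p.2 := by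
  have hm : MeasurableSet {p : Square × Square | p.1 ≠ p.2} :=
    (isClosed_eq continuous_fst continuous_snd).isOpen_compl.measurableSet
  rw [Measure.ae_prod_iff_ae_ae hm]
  refine Eventually.of_forall fun x => ?_
  have : ({x} : Set Square)ᶜ ∈ ae lebSquare := compl_mem_ae_iff.2 (measure_singleton x)
  filter_upwards [this] with y hy
  exact fun h => hy h.symm

/-- Almost every configuration has no coincident points. -/
theorem ae_distinct (N : ℕ) : ∀ᵐ c ∂(lebConfig N),
    (∀ i j, i ≠ j → c.1 i ≠ c.1 j) ∧ (∀ i j, i ≠ j → c.2 i ≠ c.2 j) ∧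
      ∀ i j, c.1 i ≠ c.2 j := by
  refine Filter.Eventually.and ?_ (Filter.Eventually.and ?_ ?_)
  · refine ae_all_iff.2 fun i => ae_all_iff.2 fun j => ?_
    by_cases hij : i = j
    · exact Eventually.of_forall fun c h => absurd hij h
    · filter_upwards [(measurePreserving_pair_fst hij).quasiMeasurePreserving.ae ae_fst_ne_snd]
        with c hc _ using hc
  · refine ae_all_iff.2 fun i => ae_all_iff.2 fun j => ?_
    by_cases hij : i = j
    · exact Eventually.of_forall fun c h => absurd hij h
    · filter_upwards [(measurePreserving_pair_snd hij).quasiMeasurePreserving.ae ae_fst_ne_snd]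
        with c hc _ using hc
  · exact ae_all_iff.2 fun i => ae_all_iff.2 fun j =>
      (measurePreserving_pair_cross i j).quasiMeasurePreserving.ae ae_fst_ne_snd

/-- `∫ |x - y|^{-β} dx` is bounded uniformly in `y` for `β < 2`. -/
theorem exists_lintegral_dist_rpow_le {β : ℝ} (hβ : β < 2) :
    ∃ C : ℝ, 0 < C ∧ ∀ y : Square,
      ∫⁻ x, ENNReal.ofReal (dist x y ^ (-β)) ∂lebSquare ≤ ENNReal.ofReal C := by
  have hint : IntegrableOn (fun x : Plane => ‖x‖ ^ (-β)) (Metric.ball 0 2) := by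
    refine integrableOn_ball_of_norm_le_rpow (C := 1) (α := β) (by simp) (by simpa using hβ)
      (Eventually.of_forall fun x => ?_) (Measurable.aestronglyMeasurable (by fun_prop))
    rw [Real.norm_eq_abs, abs_of_nonneg (by positivity), one_mul]
  set I := ∫⁻ x in Metric.ball (0 : Plane) 2, ENNReal.ofReal (‖x‖ ^ (-β)) with hI
  have hIfin : I < ⊤ := by
    have := hint.2
    rw [hasFiniteIntegral_iff_norm] at this
    refine lt_of_le_of_lt (le_of_eq ?_) this
    refine lintegral_congr fun x => ?_
    rw [Real.norm_eq_abs, abs_of_nonneg (by positivity)]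
  refine ⟨I.toReal + 1, by positivity, fun y => ?_⟩
  have h1 : ∫⁻ x, ENNReal.ofReal (dist x y ^ (-β)) ∂lebSquare
      = ∫⁻ x in squareSet, ENNReal.ofReal (‖x - y.1‖ ^ (-β)) := by
    rw [← lintegral_subtype_comap measurableSet_squareSet]
    refine lintegral_congr fun x => ?_
    rw [Subtype.dist_eq, dist_eq_norm]
  have h2 : ∀ x ∈ squareSet, ENNReal.ofReal (‖x - y.1‖ ^ (-β))
      = (Metric.ball (0 : Plane) 2).indicator (fun x => ENNReal.ofReal (‖x‖ ^ (-β)))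
        (x - y.1) := by
    intro x hx
    rw [Set.indicator_of_mem]
    have := norm_sub_sq_le_two ⟨x, hx⟩ y
    simp only at this
    rw [mem_ball_zero_iff]
    nlinarith [norm_nonneg (x - y.1)]
  rw [h1, setLIntegral_congr_fun measurableSet_squareSet h2]
  calc _ ≤ ∫⁻ x : Plane, (Metric.ball (0 : Plane) 2).indicator
        (fun x => ENNReal.ofReal (‖x‖ ^ (-β))) (x - y.1) := setLIntegral_le_lintegral _ _
    _ = I := by
        rw [lintegral_sub_right_eq_self (fun x => (Metric.ball (0 : Plane) 2).indicator
          (fun x => ENNReal.ofReal (‖x‖ ^ (-β))) x) y.1, lintegral_indicator measurableSet_ball]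
    _ = ENNReal.ofReal I.toReal := (ENNReal.ofReal_toReal hIfin.ne).symm
    _ ≤ _ := ENNReal.ofReal_le_ofReal (by linarith)

theorem lintegral_pi_prod {N : ℕ} {f : Square → ℝ≥0∞} (hf : Measurable f) :
    ∫⁻ x : Fin N → Square, ∏ i, f (x i) ∂(Measure.pi fun _ => lebSquare)
      = (∫⁻ x, f x ∂lebSquare) ^ N := by
  have h := ProbabilityTheory.lintegral_prod_eq_prod_lintegral_of_indepFun
    (μ := Measure.pi fun _ : Fin N => lebSquare) Finset.univ
    (fun i (x : Fin N → Square) => f (x i))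
    (ProbabilityTheory.iIndepFun_pi (X := fun _ => f) fun _ => hf.aemeasurable)
    (fun i => hf.comp (measurable_pi_apply i))
  rw [h, Finset.prod_congr rfl fun i _ =>
    (measurePreserving_eval (fun _ : Fin N => lebSquare) i).lintegral_comp hf]
  simp

theorem lintegral_prod_sum_le {β C : ℝ} (hC : ∀ y : Square,
      ∫⁻ x, ENNReal.ofReal (dist x y ^ (-β)) ∂lebSquare ≤ ENNReal.ofReal C) (N : ℕ) :
    ∫⁻ c : Config N, ∏ i, ∑ j, ENNReal.ofReal (dist (c.1 i) (c.2 j) ^ (-β)) ∂(lebConfig N)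
      ≤ (N * ENNReal.ofReal C) ^ N := by
  rw [lebConfig, lintegral_prod_symm _ (Measurable.aemeasurable (by fun_prop))]
  have h : ∀ y : Fin N → Square, ∫⁻ x : Fin N → Square,
      ∏ i, ∑ j, ENNReal.ofReal (dist (x i) (y j) ^ (-β)) ∂(Measure.pi fun _ => lebSquare)
      ≤ (N * ENNReal.ofReal C) ^ N := by
    intro y
    rw [lintegral_pi_prod (f := fun x => ∑ j, ENNReal.ofReal (dist x (y j) ^ (-β)))
      (by fun_prop)]
    gcongr
    rw [lintegral_finsetSum _ (fun j _ => by fun_prop)]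
    calc _ ≤ ∑ _ : Fin N, ENNReal.ofReal C := Finset.sum_le_sum fun j _ => hC (y j)
      _ = _ := by simp
  calc _ ≤ ∫⁻ _ : Fin N → Square, (N * ENNReal.ofReal C) ^ N
        ∂(Measure.pi fun _ : Fin N => lebSquare) := lintegral_mono h
    _ = _ := by simp

theorem lintegral_prod_sum_le' {β C : ℝ} (hC : ∀ y : Square,
      ∫⁻ x, ENNReal.ofReal (dist x y ^ (-β)) ∂lebSquare ≤ ENNReal.ofReal C) (N : ℕ) :
    ∫⁻ c : Config N, ∏ j, ∑ i, ENNReal.ofReal (dist (c.1 i) (c.2 j) ^ (-β)) ∂(lebConfig N)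
      ≤ (N * ENNReal.ofReal C) ^ N := by
  have hs : MeasurePreserving (Prod.swap : Config N → Config N) (lebConfig N) (lebConfig N) :=
    Measure.measurePreserving_swap
  refine le_trans (le_of_eq ?_) (lintegral_prod_sum_le hC N)
  rw [← hs.lintegral_comp (f := fun c : Config N => ∏ i, ∑ j,
    ENNReal.ofReal (dist (c.1 i) (c.2 j) ^ (-β))) (by fun_prop)]
  simp only [Prod.fst_swap, Prod.snd_swap, dist_comm]

@[fun_prop]
theorem measurable_energy (N : ℕ) : Measurable (energy : Config N → ℝ) := by
  unfold energy
  refine Measurable.add (Finset.measurable_sum _ fun i _ => Finset.measurable_sum _ fun j _ => ?_)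
    (by fun_prop)
  split_ifs <;> fun_prop

@[fun_prop]
theorem measurable_weight (β : ℝ) (N : ℕ) :
    Measurable (weight β : Config N → ℝ≥0∞) := by
  unfold weight; fun_prop

/-! ### Bounds on the Boltzmann weight and on the partition function -/

/-- The factors `r ^ (-β / 2)` that the self-energies contribute are attached to the `2 N` charges;
by `P Q ≤ P ^ 2 + Q ^ 2` they are separated into the two species, at the cost of the exponent `-β`. Then
the points of one species are independent given those of the other. -/
theorem weight_le {β : ℝ} {N : ℕ} (hN : 1 ≤ N) (μ ν : Measure Square)
    [IsProbabilityMeasure μ] [IsProbabilityMeasure ν] {c : Config N}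
    (hx : ∀ i j, i ≠ j → c.1 i ≠ c.1 j) (hy : ∀ i j, i ≠ j → c.2 i ≠ c.2 j)
    (hxy : ∀ i j, c.1 i ≠ c.2 j) {τ η t : ℝ} (hβ : 0 < β) (hτ : 0 < τ) (hη : 0 < η)
    (ht : N ^ 2 * t ≤
      2 * N * (∑ i, chargePotential μ ν τ (c.1 i).1 - ∑ j, chargePotential μ ν τ (c.2 j).1)) :
    weight β c ≤ ENNReal.ofReal (Real.exp (-(β / 2) * (N ^ 2 * t
        - N ^ 2 * (chargeEnergy μ ν (τ + τ) + 4 * η / τ + 2 * η)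
        - 2 * N * logKernel (2 * η)))) *
      (∏ i, ∑ j, ENNReal.ofReal (dist (c.1 i) (c.2 j) ^ (-β))
        + ∏ j, ∑ i, ENNReal.ofReal (dist (c.1 i) (c.2 j) ^ (-β))) := by
  have : Nonempty (Fin N) := ⟨⟨0, hN⟩⟩
  have hmin : ∀ i, ∃ j, ∀ k, dist (c.1 i) (c.2 j) ≤ dist (c.1 i) (c.2 k) := fun i =>
    Finite.exists_min fun j => dist (c.1 i) (c.2 j)
  have hmin' : ∀ j, ∃ i, ∀ k, dist (c.1 i) (c.2 j) ≤ dist (c.1 k) (c.2 j) := fun j =>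
    Finite.exists_min fun i => dist (c.1 i) (c.2 j)
  choose a ha using hmin
  choose b hb using hmin'
  have hpos : ∀ i j, 0 < dist (c.1 i) (c.2 j) := fun i j => dist_pos.2 (hxy i j)
  have key := energy_ge hN μ ν c hx hy (r := fun i => dist (c.1 i) (c.2 (a i)))
    (r' := fun j => dist (c.1 (b j)) (c.2 j)) (fun i => hpos _ _) (fun j => hpos _ _)
    (fun i j => ha i j) (fun i j => hb j i) hτ hη
  set K := N ^ 2 * t - N ^ 2 * (chargeEnergy μ ν (τ + τ) + 4 * η / τ + 2 * η)
        - 2 * N * logKernel (2 * η) with hK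
  set s := ∑ i, Real.log (dist (c.1 i) (c.2 (a i))) with hs
  set s' := ∑ j, Real.log (dist (c.1 (b j)) (c.2 j)) with hs'
  have hen : K + s + s' ≤ energy c := by linarith
  have hsq : ∀ u : ℝ, Real.exp (-(β / 2) * u) ^ 2 = Real.exp (-β * u) := fun u => by
    rw [← Real.exp_nat_mul]; congr 1; push_cast; ring
  have hlogpow : ∀ d : ℝ, 0 < d → Real.exp (-β * Real.log d) = d ^ (-β) := fun d hd => by
    rw [Real.rpow_def_of_pos hd, mul_comm]
  have h1 : Real.exp (-(β / 2) * energy c)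
      ≤ Real.exp (-(β / 2) * K) * (Real.exp (-β * s) + Real.exp (-β * s')) := by
    calc Real.exp (-(β / 2) * energy c) ≤ Real.exp (-(β / 2) * (K + s + s')) := by
          apply Real.exp_le_exp.2; nlinarith
      _ = Real.exp (-(β / 2) * K) * (Real.exp (-(β / 2) * s) * Real.exp (-(β / 2) * s')) := by
          rw [← Real.exp_add, ← Real.exp_add]; congr 1; ring
      _ ≤ _ := by
          refine mul_le_mul_of_nonneg_left ?_ (Real.exp_pos _).le
          rw [← hsq, ← hsq]
          nlinarith [sq_nonneg (Real.exp (-(β / 2) * s) - Real.exp (-(β / 2) * s')),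
            Real.exp_pos (-(β / 2) * s), Real.exp_pos (-(β / 2) * s')]
  have h2 : ENNReal.ofReal (Real.exp (-β * s))
      ≤ ∏ i, ∑ j, ENNReal.ofReal (dist (c.1 i) (c.2 j) ^ (-β)) := by
    rw [hs, Finset.mul_sum, Real.exp_sum, ENNReal.ofReal_prod_of_nonneg
      fun _ _ => (Real.exp_pos _).le]
    refine Finset.prod_le_prod' fun i _ => ?_
    rw [hlogpow _ (hpos _ _)]
    exact Finset.single_le_sum (f := fun j => ENNReal.ofReal (dist (c.1 i) (c.2 j) ^ (-β)))
      (fun _ _ => zero_le) (Finset.mem_univ (a i))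
  have h3 : ENNReal.ofReal (Real.exp (-β * s'))
      ≤ ∏ j, ∑ i, ENNReal.ofReal (dist (c.1 i) (c.2 j) ^ (-β)) := by
    rw [hs', Finset.mul_sum, Real.exp_sum, ENNReal.ofReal_prod_of_nonneg
      fun _ _ => (Real.exp_pos _).le]
    refine Finset.prod_le_prod' fun j _ => ?_
    rw [hlogpow _ (hpos _ _)]
    exact Finset.single_le_sum (f := fun i => ENNReal.ofReal (dist (c.1 i) (c.2 j) ^ (-β)))
      (fun _ _ => zero_le) (Finset.mem_univ (b j))
  calc weight β c = ENNReal.ofReal (Real.exp (-(β / 2) * energy c)) := rfl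
    _ ≤ ENNReal.ofReal (Real.exp (-(β / 2) * K) * (Real.exp (-β * s) + Real.exp (-β * s'))) :=
        ENNReal.ofReal_le_ofReal h1
    _ = ENNReal.ofReal (Real.exp (-(β / 2) * K)) * (ENNReal.ofReal (Real.exp (-β * s))
          + ENNReal.ofReal (Real.exp (-β * s'))) := by
        rw [ENNReal.ofReal_mul (Real.exp_pos _).le, ENNReal.ofReal_add (Real.exp_pos _).le
          (Real.exp_pos _).le]
    _ ≤ _ := by gcongr

theorem setLIntegral_weight_le {β C : ℝ} (hC : ∀ y : Square,
      ∫⁻ x, ENNReal.ofReal (dist x y ^ (-β)) ∂lebSquare ≤ ENNReal.ofReal C)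
    {N : ℕ} (hN : 1 ≤ N) (μ ν : Measure Square) [IsProbabilityMeasure μ] [IsProbabilityMeasure ν]
    {τ η t : ℝ} (hβ : 0 < β) (hτ : 0 < τ) (hη : 0 < η) {S : Set (Config N)}
    (hS : MeasurableSet S) (ht : ∀ c ∈ S, N ^ 2 * t ≤
      2 * N * (∑ i, chargePotential μ ν τ (c.1 i).1 - ∑ j, chargePotential μ ν τ (c.2 j).1)) :
    ∫⁻ c in S, weight β c ∂(lebConfig N) ≤ ENNReal.ofReal (Real.exp (-(β / 2) * (N ^ 2 * t
        - N ^ 2 * (chargeEnergy μ ν (τ + τ) + 4 * η / τ + 2 * η)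
        - 2 * N * logKernel (2 * η)))) * (2 * (N * ENNReal.ofReal C) ^ N) := by
  set e := ENNReal.ofReal (Real.exp (-(β / 2) * (N ^ 2 * t
        - N ^ 2 * (chargeEnergy μ ν (τ + τ) + 4 * η / τ + 2 * η)
        - 2 * N * logKernel (2 * η)))) with he
  calc ∫⁻ c in S, weight β c ∂(lebConfig N)
      ≤ ∫⁻ c in S, e * (∏ i, ∑ j, ENNReal.ofReal (dist (c.1 i) (c.2 j) ^ (-β))
        + ∏ j, ∑ i, ENNReal.ofReal (dist (c.1 i) (c.2 j) ^ (-β))) ∂(lebConfig N) := by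
        refine lintegral_mono_ae ?_
        filter_upwards [ae_restrict_of_ae (ae_distinct N), ae_restrict_mem hS] with c hc hcS
        exact weight_le hN μ ν hc.1 hc.2.1 hc.2.2 hβ hτ hη (ht c hcS)
    _ ≤ ∫⁻ c, e * (∏ i, ∑ j, ENNReal.ofReal (dist (c.1 i) (c.2 j) ^ (-β))
        + ∏ j, ∑ i, ENNReal.ofReal (dist (c.1 i) (c.2 j) ^ (-β))) ∂(lebConfig N) :=
        setLIntegral_le_lintegral _ _
    _ = e * (∫⁻ c, ∏ i, ∑ j, ENNReal.ofReal (dist (c.1 i) (c.2 j) ^ (-β)) ∂(lebConfig N)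
        + ∫⁻ c, ∏ j, ∑ i, ENNReal.ofReal (dist (c.1 i) (c.2 j) ^ (-β)) ∂(lebConfig N)) := by
        rw [lintegral_const_mul _ (by fun_prop), lintegral_add_left (by fun_prop)]
    _ ≤ _ := by
        rw [two_mul]
        gcongr
        · exact lintegral_prod_sum_le hC N
        · exact lintegral_prod_sum_le' hC N

theorem partitionFunction_lt_top {β : ℝ} (hβ : 0 < β) (hβ2 : β < 2) {N : ℕ} (hN : 1 ≤ N) :
    partitionFunction β N < ⊤ := by
  obtain ⟨C, -, hC⟩ := exists_lintegral_dist_rpow_le hβ2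
  -- The reference charge `μ - ν` plays no role here; it is taken to be `0`.
  have h := setLIntegral_weight_le hC hN lebSquare lebSquare (t := 0) hβ one_pos one_pos
    MeasurableSet.univ (fun c _ => by simp [chargePotential])
  rw [setLIntegral_univ] at h
  refine h.trans_lt (ENNReal.mul_lt_top ENNReal.ofReal_lt_top
    (ENNReal.mul_lt_top (by simp) (ENNReal.pow_lt_top ?_)))
  exact ENNReal.mul_lt_top (by simp) ENNReal.ofReal_lt_top

theorem partitionFunction_pos (β : ℝ) (N : ℕ) : 0 < partitionFunction β N := by
  rw [partitionFunction, lintegral_pos_iff_support (measurable_weight β N)]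
  have : Function.support (weight β : Config N → ℝ≥0∞) = Set.univ := by
    ext c
    simp only [Function.mem_support, Set.mem_univ, iff_true, weight]
    exact (ENNReal.ofReal_pos.2 (Real.exp_pos _)).ne'
  rw [this]; simp

theorem isProbabilityMeasure_gibbs {β : ℝ} (hβ : 0 < β) (hβ2 : β < 2) {N : ℕ} (hN : 1 ≤ N) :
    IsProbabilityMeasure (gibbs β N) := by
  constructor
  rw [gibbs, Measure.smul_apply, withDensity_apply _ MeasurableSet.univ, setLIntegral_univ,
    smul_eq_mul]
  exact ENNReal.inv_mul_cancel (partitionFunction_pos β N).ne'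
    (partitionFunction_lt_top hβ hβ2 hN).ne

theorem integrable_log_dist : Integrable (fun p : Square × Square => Real.log (dist p.1 p.2))
    (lebSquare.prod lebSquare) := by
  obtain ⟨C, hC0, hC⟩ := exists_lintegral_dist_rpow_le one_lt_two
  have h1 : Integrable (fun p : Square × Square => dist p.1 p.2 ^ (-1 : ℝ))
      (lebSquare.prod lebSquare) := by
    refine ⟨Measurable.aestronglyMeasurable (by fun_prop), ?_⟩
    rw [hasFiniteIntegral_iff_norm, lintegral_prod_symm _ (Measurable.aemeasurable (by fun_prop))]
    refine lt_of_le_of_lt (lintegral_mono (g := fun _ => ENNReal.ofReal C) fun y => ?_)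
      (by simp)
    refine le_trans (le_of_eq (lintegral_congr fun x => ?_)) (hC y)
    rw [Real.norm_eq_abs, abs_of_nonneg (by positivity)]
  refine (h1.add (integrable_const 2)).mono' (Measurable.aestronglyMeasurable (by fun_prop)) ?_
  filter_upwards [ae_fst_ne_snd] with p hp
  have hd : 0 < dist p.1 p.2 := dist_pos.2 hp
  have h2 : dist p.1 p.2 ≤ 2 := by
    have := norm_sub_sq_le_two p.1 p.2
    rw [Subtype.dist_eq, dist_eq_norm]
    nlinarith [norm_nonneg (p.1.1 - p.2.1)]
  simp only [Pi.add_apply, Real.norm_eq_abs, Real.rpow_neg_one]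
  have h3 := Real.log_le_sub_one_of_pos hd
  have h4 := Real.one_sub_inv_le_log_of_pos hd
  have h5 : 0 < (dist p.1 p.2)⁻¹ := by positivity
  rw [abs_le]; constructor <;> linarith

theorem integral_log_dist_le_one :
    ∫ p : Square × Square, Real.log (dist p.1 p.2) ∂(lebSquare.prod lebSquare) ≤ 1 := by
  have h : ∀ p : Square × Square, Real.log (dist p.1 p.2) ≤ 1 := by
    intro p
    have h2 : dist p.1 p.2 ≤ 2 := by
      have := norm_sub_sq_le_two p.1 p.2
      rw [Subtype.dist_eq, dist_eq_norm]
      nlinarith [norm_nonneg (p.1.1 - p.2.1)]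
    rcases eq_or_lt_of_le (dist_nonneg (x := p.1) (y := p.2)) with h0 | h0
    · rw [← h0, Real.log_zero]; exact zero_le_one
    · linarith [Real.log_le_sub_one_of_pos h0]
  have := integral_mono integrable_log_dist (integrable_const (1 : ℝ)) h
  simpa using this

theorem integrable_log_dist_comp {N : ℕ} {f : Config N → Square × Square}
    (hf : MeasurePreserving f (lebConfig N) (lebSquare.prod lebSquare)) :
    Integrable (fun c => Real.log (dist (f c).1 (f c).2)) (lebConfig N) :=
  hf.integrable_comp_of_integrable integrable_log_dist

theorem integral_log_dist_comp {N : ℕ} {f : Config N → Square × Square}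
    (hf : MeasurePreserving f (lebConfig N) (lebSquare.prod lebSquare)) :
    ∫ c, Real.log (dist (f c).1 (f c).2) ∂(lebConfig N)
      = ∫ p : Square × Square, Real.log (dist p.1 p.2) ∂(lebSquare.prod lebSquare) := by
  have h := integral_map hf.measurable.aemeasurable
    (f := fun p : Square × Square => Real.log (dist p.1 p.2))
    (by rw [hf.map_eq]; exact integrable_log_dist.aestronglyMeasurable)
  rw [hf.map_eq] at h
  exact h.symm

/-- In the mean over independent uniform points all interactions cancel, except for `2 N` of those
between opposite charges. -/
theorem integrable_energy_and_integral_le (N : ℕ) :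
    Integrable (energy : Config N → ℝ) (lebConfig N) ∧
      ∫ c : Config N, energy c ∂(lebConfig N) ≤ 2 * N := by
  have hI1 := integral_log_dist_le_one
  generalize hI :
    ∫ p : Square × Square, Real.log (dist p.1 p.2) ∂(lebSquare.prod lebSquare) = I at hI1
  have hlike : ∀ i j : Fin N, Integrable (fun c : Config N => if i ≠ j then
        - Real.log (dist (c.1 i) (c.1 j)) - Real.log (dist (c.2 i) (c.2 j)) else 0)
        (lebConfig N) ∧
      ∫ c : Config N, (if i ≠ j then
        - Real.log (dist (c.1 i) (c.1 j)) - Real.log (dist (c.2 i) (c.2 j)) else 0)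
        ∂(lebConfig N) = if i = j then 0 else -(2 * I) := by
    intro i j
    by_cases hij : i = j
    · simp [hij]
    · have h1 := integrable_log_dist_comp (measurePreserving_pair_fst hij)
      have h1' := integral_log_dist_comp (measurePreserving_pair_fst hij)
      have h2 := integrable_log_dist_comp (measurePreserving_pair_snd hij)
      have h2' := integral_log_dist_comp (measurePreserving_pair_snd hij)
      simp only [hI] at h1 h1' h2 h2'
      simp only [ne_eq, hij, not_false_eq_true, if_true, if_false]
      have h1n : Integrable (fun c : Config N => -Real.log (dist (c.1 i) (c.1 j)))
        (lebConfig N) := h1.neg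
      refine ⟨h1n.sub h2, ?_⟩
      rw [integral_sub h1n h2, integral_neg, h1', h2']; ring
  have hcross : ∀ i j : Fin N,
      Integrable (fun c : Config N => Real.log (dist (c.1 i) (c.2 j))) (lebConfig N) ∧
      ∫ c : Config N, Real.log (dist (c.1 i) (c.2 j)) ∂(lebConfig N) = I :=
    fun i j => by
      have h1 := integrable_log_dist_comp (measurePreserving_pair_cross i j)
      have h2 := integral_log_dist_comp (measurePreserving_pair_cross i j)
      rw [hI] at h2
      exact ⟨h1, h2⟩
  have hi1 : Integrable (fun c : Config N => ∑ i : Fin N, ∑ j : Fin N,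
      if i ≠ j then - Real.log (dist (c.1 i) (c.1 j)) - Real.log (dist (c.2 i) (c.2 j)) else 0)
      (lebConfig N) :=
    integrable_finsetSum _ fun i _ => integrable_finsetSum _ fun j _ => (hlike i j).1
  have hi2 : Integrable (fun c : Config N => 2 * ∑ i : Fin N, ∑ j : Fin N,
      Real.log (dist (c.1 i) (c.2 j))) (lebConfig N) :=
    (integrable_finsetSum _ fun i _ => integrable_finsetSum _ fun j _ =>
      (hcross i j).1).const_mul 2
  have hv1 : ∫ c : Config N, (∑ i : Fin N, ∑ j : Fin N, if i ≠ j then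
      - Real.log (dist (c.1 i) (c.1 j)) - Real.log (dist (c.2 i) (c.2 j)) else 0)
      ∂(lebConfig N) = ∑ i : Fin N, ∑ j : Fin N, if i = j then 0 else -(2 * I) := by
    rw [integral_finsetSum _ fun i _ => integrable_finsetSum _ fun j _ => (hlike i j).1]
    refine Finset.sum_congr rfl fun i _ => ?_
    rw [integral_finsetSum _ fun j _ => (hlike i j).1]
    exact Finset.sum_congr rfl fun j _ => (hlike i j).2
  have hv2 : ∫ c : Config N, 2 * ∑ i : Fin N, ∑ j : Fin N, Real.log (dist (c.1 i) (c.2 j))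
      ∂(lebConfig N) = 2 * ∑ _i : Fin N, ∑ _j : Fin N, I := by
    rw [integral_const_mul,
      integral_finsetSum _ fun i _ => integrable_finsetSum _ fun j _ => (hcross i j).1]
    congr 1
    refine Finset.sum_congr rfl fun i _ => ?_
    rw [integral_finsetSum _ fun j _ => (hcross i j).1]
    exact Finset.sum_congr rfl fun j _ => (hcross i j).2
  have hd : ∑ i : Fin N, ∑ j : Fin N, (if i = j then 0 else -(2 * I))
      = -(2 * I) * (N * N) + 2 * I * N := by
    have : ∀ i j : Fin N, (if i = j then 0 else -(2 * I))
        = -(2 * I) + if i = j then 2 * I else 0 := by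
      intro i j; split_ifs <;> ring
    simp only [this, Finset.sum_add_distrib]
    simp
    ring
  unfold energy
  refine ⟨hi1.add hi2, ?_⟩
  rw [integral_add hi1 hi2, hv1, hv2, hd]
  calc (-(2 * I) * (N * N) + 2 * I * N) + 2 * ∑ _i : Fin N, ∑ _j : Fin N, I
      = 2 * N * I := by simp; ring
    _ ≤ 2 * N := by nlinarith [N.cast_nonneg (α := ℝ)]

/-- Jensen's inequality under the uniform measure. -/
theorem le_partitionFunction {β : ℝ} (hβ : 0 < β) (hβ2 : β < 2) {N : ℕ} (hN : 1 ≤ N) :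
    ENNReal.ofReal (Real.exp (-(β * N))) ≤ partitionFunction β N := by
  obtain ⟨hint, hle⟩ := integrable_energy_and_integral_le N
  have hexp : Integrable (fun c : Config N => Real.exp (-(β / 2) * energy c)) (lebConfig N) := by
    refine ⟨Measurable.aestronglyMeasurable (by fun_prop), ?_⟩
    rw [hasFiniteIntegral_iff_norm]
    refine lt_of_le_of_lt (le_of_eq (lintegral_congr fun c => ?_))
      (partitionFunction_lt_top hβ hβ2 hN)
    rw [Real.norm_eq_abs, Real.abs_exp, weight]
  have hJ := convexOn_exp.map_integral_le (μ := lebConfig N)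
    (f := fun c : Config N => -(β / 2) * energy c) Real.continuous_exp.continuousOn isClosed_univ
    (Eventually.of_forall fun _ => Set.mem_univ _) (hint.const_mul _) hexp
  rw [integral_const_mul] at hJ
  rw [partitionFunction]
  simp only [weight]
  rw [← ofReal_integral_eq_lintegral_ofReal hexp
    (Eventually.of_forall fun c => (Real.exp_pos _).le)]
  refine ENNReal.ofReal_le_ofReal (le_trans (Real.exp_le_exp.2 ?_) hJ)
  nlinarith

/-! ### The large deviation upper bound at a fixed regularization -/

/-- Integrals of a bounded Lipschitz function are controlled by the Dudley distance. -/
theorem abs_integral_sub_le_dudleyDist {X : Type*} [PseudoMetricSpace X] [MeasurableSpace X]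
    {P Q : Measure X} [IsProbabilityMeasure P] [IsProbabilityMeasure Q] {f : X → ℝ} {L : ℝ}
    (hL : 0 < L) (hlip : ∀ x y, |f x - f y| ≤ L * dist x y) (hb : ∀ x, |f x| ≤ L) :
    |∫ x, f x ∂P - ∫ x, f x ∂Q| ≤ L * dudleyDist P Q := by
  have hbdd : BddAbove {t : ℝ | ∃ F : X → ℝ, LipschitzWith 1 F ∧ (∀ x, |F x| ≤ 1) ∧
      t = ∫ x, F x ∂P - ∫ x, F x ∂Q} := by
    refine ⟨2, ?_⟩
    rintro t ⟨F, -, hF, rfl⟩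
    have h1 := norm_integral_le_of_norm_le_const (μ := P) (f := F) (Eventually.of_forall hF)
    have h2 := norm_integral_le_of_norm_le_const (μ := Q) (f := F) (Eventually.of_forall hF)
    simp only [probReal_univ, mul_one, Real.norm_eq_abs] at h1 h2
    have := abs_le.1 h1
    have := abs_le.1 h2
    linarith
  have key : ∀ s : ℝ, |s| = 1 →
      s * (∫ x, f x ∂P - ∫ x, f x ∂Q) ≤ L * dudleyDist P Q := by
    intro s hs
    have h : L⁻¹ * s * (∫ x, f x ∂P - ∫ x, f x ∂Q) ≤ dudleyDist P Q := by
      refine le_csSup hbdd ⟨fun x => L⁻¹ * s * f x, ?_, ?_, ?_⟩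
      · refine LipschitzWith.of_dist_le_mul fun x y => ?_
        rw [Real.dist_eq, ← mul_sub, abs_mul, abs_mul, hs, abs_of_pos (inv_pos.2 hL), mul_one,
          NNReal.coe_one, one_mul, inv_mul_le_iff₀ hL]
        exact hlip x y
      · intro x
        rw [abs_mul, abs_mul, hs, abs_of_pos (inv_pos.2 hL), mul_one, inv_mul_le_iff₀ hL, mul_one]
        exact hb x
      · rw [integral_const_mul, integral_const_mul, mul_sub]
    rw [mul_assoc, inv_mul_le_iff₀ hL] at h
    exact h
  rw [abs_le]
  have h1 := key 1 (by simp)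
  have h2 := key (-1) (by simp)
  constructor <;> linarith

theorem abs_logPotential_sub_le (μ : Measure Square) [IsProbabilityMeasure μ] {τ : ℝ}
    (hτ : 0 < τ) (x y : Square) :
    |logPotential μ τ x.1 - logPotential μ τ y.1| ≤ 2 / τ * dist x y := by
  have hker : ∀ (x y u : Square), logKernel (‖x.1 - u.1‖ ^ 2 + τ)
      - logKernel (‖y.1 - u.1‖ ^ 2 + τ) ≤ 2 / τ * dist x y := by
    intro x y u
    have hn : ∀ v w : Square, ‖v.1 - w.1‖ ≤ 2 := fun v w => by
      have := norm_sub_sq_le_two v w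
      nlinarith [norm_nonneg (v.1 - w.1)]
    have h2 : ‖y.1 - u.1‖ ≤ ‖x.1 - u.1‖ + dist x y := by
      rw [Subtype.dist_eq, dist_eq_norm, norm_sub_rev x.1 y.1]
      calc ‖y.1 - u.1‖ = ‖(x.1 - u.1) + (y.1 - x.1)‖ := by congr 1; abel
        _ ≤ _ := norm_add_le _ _
    have hd : 0 ≤ dist x y := dist_nonneg
    rcases le_total (‖y.1 - u.1‖ ^ 2) (‖x.1 - u.1‖ ^ 2) with h | h
    · have := logKernel_anti (v := ‖y.1 - u.1‖ ^ 2 + τ) (w := ‖x.1 - u.1‖ ^ 2 + τ)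
        (by positivity) (by linarith)
      have : 0 ≤ 2 / τ * dist x y := by positivity
      linarith
    · have h3 := logKernel_sub_le (v := ‖x.1 - u.1‖ ^ 2 + τ)
        (s := ‖y.1 - u.1‖ ^ 2 - ‖x.1 - u.1‖ ^ 2) (by positivity) (by linarith)
      have h4 : ‖x.1 - u.1‖ ^ 2 + τ + (‖y.1 - u.1‖ ^ 2 - ‖x.1 - u.1‖ ^ 2)
          = ‖y.1 - u.1‖ ^ 2 + τ := by ring
      rw [h4] at h3
      refine h3.trans ?_
      have h5 : ‖y.1 - u.1‖ ^ 2 - ‖x.1 - u.1‖ ^ 2 ≤ 4 * dist x y := by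
        have := hn y u
        have := hn x u
        nlinarith [norm_nonneg (y.1 - u.1), norm_nonneg (x.1 - u.1)]
      calc (‖y.1 - u.1‖ ^ 2 - ‖x.1 - u.1‖ ^ 2) / (2 * (‖x.1 - u.1‖ ^ 2 + τ))
          ≤ (4 * dist x y) / (2 * τ) := by
            gcongr
            nlinarith [sq_nonneg ‖x.1 - u.1‖]
        _ = 2 / τ * dist x y := by field_simp; ring
  have h1 := integrable_logKernel μ hτ x.1
  have h2 := integrable_logKernel μ hτ y.1
  rw [logPotential, logPotential, ← integral_sub h1 h2]
  have := norm_integral_le_of_norm_le_const (μ := μ)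
    (f := fun u : Square => logKernel (‖x.1 - u.1‖ ^ 2 + τ) - logKernel (‖y.1 - u.1‖ ^ 2 + τ))
    (C := 2 / τ * dist x y) (Eventually.of_forall fun u => by
      rw [Real.norm_eq_abs, abs_le]
      have h3 := hker x y u
      have h4 := hker y x u
      rw [dist_comm y x] at h4
      constructor <;> linarith)
  simpa using this

theorem exists_chargePotential_lipschitz (μ ν : Measure Square) [IsProbabilityMeasure μ]
    [IsProbabilityMeasure ν] {τ : ℝ} (hτ : 0 < τ) :
    ∃ L, 0 < L ∧ (∀ x y : Square,
        |chargePotential μ ν τ x.1 - chargePotential μ ν τ y.1| ≤ L * dist x y) ∧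
      ∀ x : Square, |chargePotential μ ν τ x.1| ≤ L := by
  set B := |logKernel τ| + |logKernel (2 + τ)| with hB
  have hB0 : 0 ≤ B := by positivity
  refine ⟨4 / τ + 2 * B, by positivity, fun x y => ?_, fun x => ?_⟩
  · have h1 := abs_le.1 (abs_logPotential_sub_le μ hτ x y)
    have h2 := abs_le.1 (abs_logPotential_sub_le ν hτ x y)
    have h3 : (4 / τ + 2 * B) * dist x y = 2 * (2 / τ * dist x y) + 2 * (B * dist x y) := by ring
    have h4 : 0 ≤ B * dist x y := by positivity
    rw [h3, abs_le]
    simp only [chargePotential]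
    constructor <;> linarith
  · have h1 := abs_le.1 (abs_logPotential_le μ hτ x)
    have h2 := abs_le.1 (abs_logPotential_le ν hτ x)
    have h3 : 0 < 4 / τ := by positivity
    rw [abs_le]
    simp only [chargePotential]
    constructor <;> linarith

theorem isProbabilityMeasure_empirical {N : ℕ} (hN : 1 ≤ N) (x : Fin N → Square) :
    IsProbabilityMeasure (empirical x) := by
  constructor
  have h0 : (N : ℝ≥0∞) ≠ 0 := by exact_mod_cast (Nat.one_le_iff_ne_zero.1 hN)
  simp only [empirical, Measure.smul_apply, Measure.finsetSum_apply, measure_univ,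
    Finset.sum_const, Finset.card_univ, Fintype.card_fin, smul_eq_mul, nsmul_eq_mul, mul_one]
  exact ENNReal.inv_mul_cancel h0 (ENNReal.natCast_ne_top N)

theorem mul_integral_empirical {N : ℕ} (hN : 1 ≤ N) (x : Fin N → Square) (f : Square → ℝ) :
    N * ∫ y, f y ∂(empirical x) = ∑ i, f (x i) := by
  have h0 : (N : ℝ) ≠ 0 := by exact_mod_cast (Nat.one_le_iff_ne_zero.1 hN)
  rw [empirical, integral_smul_measure, integral_finsetSum_measure fun i _ =>
    integrable_dirac (by simp)]
  simp [h0]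

theorem measurable_chargePotential (μ ν : Measure Square) [IsFiniteMeasure μ] [IsFiniteMeasure ν]
    (τ : ℝ) : Measurable (chargePotential μ ν τ) :=
  (measurable_logPotential μ τ).sub (measurable_logPotential ν τ)

/-- On the event, the linear term of the energy bound is controlled by the values at `(μ, ν)`, since the
regularized potential is bounded and Lipschitz. -/
theorem gibbs_nearEvent_le {β C L : ℝ} (hβ : 0 < β) (hβ2 : β < 2) (hC0 : 0 < C)
    (hC : ∀ y : Square,
      ∫⁻ x, ENNReal.ofReal (dist x y ^ (-β)) ∂lebSquare ≤ ENNReal.ofReal C)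
    (μ ν : Measure Square) [IsProbabilityMeasure μ] [IsProbabilityMeasure ν]
    {τ η : ℝ} (hτ : 0 < τ) (hη : 0 < η) (hL : 0 < L)
    (hlip : ∀ x y : Square,
        |chargePotential μ ν τ x.1 - chargePotential μ ν τ y.1| ≤ L * dist x y)
    (hb : ∀ x : Square, |chargePotential μ ν τ x.1| ≤ L) (ε : ℝ) {N : ℕ} (hN : 1 ≤ N) :
    gibbs β N (nearEvent N μ ν ε) ≤ ENNReal.ofReal (Real.exp (β * N
      - β / 2 * (N ^ 2 * (2 * (chargeEnergy μ ν τ - L * ε))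
        - N ^ 2 * (chargeEnergy μ ν (τ + τ) + 4 * η / τ + 2 * η) - 2 * N * logKernel (2 * η))
      + (Real.log 2 + N * (Real.log N + Real.log C)))) := by
  have hN0 : (0 : ℝ) < N := by exact_mod_cast hN
  have hψm := measurable_chargePotential μ ν τ
  set t := 2 * (chargeEnergy μ ν τ - L * ε) with ht
  set S : Set (Config N) := {c | N ^ 2 * t ≤ 2 * N * (∑ i, chargePotential μ ν τ (c.1 i).1
    - ∑ j, chargePotential μ ν τ (c.2 j).1)} with hS
  have hSm : MeasurableSet S := by
    refine measurableSet_le measurable_const (Measurable.const_mul ?_ _)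
    refine Measurable.sub ?_ ?_ <;> refine Finset.measurable_sum _ fun i _ => hψm.comp (by fun_prop)
  have hsub : nearEvent N μ ν ε ⊆ S := by
    intro c hc
    have hc' : dudleyDist (empirical c.1) μ + dudleyDist (empirical c.2) ν ≤ ε := hc
    have := isProbabilityMeasure_empirical hN c.1
    have := isProbabilityMeasure_empirical hN c.2
    have h1 := abs_le.1 (abs_integral_sub_le_dudleyDist (P := empirical c.1) (Q := μ) hL hlip hb)
    have h2 := abs_le.1 (abs_integral_sub_le_dudleyDist (P := empirical c.2) (Q := ν) hL hlip hb)
    have h3 := mul_integral_empirical hN c.1 fun x => chargePotential μ ν τ x.1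
    have h4 := mul_integral_empirical hN c.2 fun x => chargePotential μ ν τ x.1
    rw [hS, Set.mem_ofPred_eq, ← h3, ← h4, ht, chargeEnergy]
    have h5 : ∫ x : Square, chargePotential μ ν τ x.1 ∂μ
        - ∫ x : Square, chargePotential μ ν τ x.1 ∂ν - L * ε
        ≤ ∫ x : Square, chargePotential μ ν τ x.1 ∂(empirical c.1)
          - ∫ x : Square, chargePotential μ ν τ x.1 ∂(empirical c.2) := by
      have := mul_le_mul_of_nonneg_left hc' hL.le
      linarith [h1.1, h2.2]
    have h6 := mul_le_mul_of_nonneg_left h5 (by positivity : (0 : ℝ) ≤ 2 * N ^ 2)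
    linarith
  have hSle := setLIntegral_weight_le hC hN μ ν hβ hτ hη hSm (t := t) (fun c hc => hc)
  have hZ := le_partitionFunction hβ hβ2 hN
  have hC' : (2 * (N * ENNReal.ofReal C) ^ N : ℝ≥0∞)
      = ENNReal.ofReal (Real.exp (Real.log 2 + N * (Real.log N + Real.log C))) := by
    rw [Real.exp_add, Real.exp_log two_pos, Real.exp_nat_mul, Real.exp_add, Real.exp_log hN0,
      Real.exp_log hC0, ENNReal.ofReal_mul zero_le_two, ENNReal.ofReal_pow (by positivity),
      ENNReal.ofReal_mul hN0.le, ENNReal.ofReal_natCast, ENNReal.ofReal_ofNat]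
  rw [hC', ← ENNReal.ofReal_mul (Real.exp_pos _).le, ← Real.exp_add] at hSle
  calc gibbs β N (nearEvent N μ ν ε) ≤ gibbs β N S := measure_mono hsub
    _ = (partitionFunction β N)⁻¹ * ∫⁻ c in S, weight β c ∂(lebConfig N) := by
        rw [gibbs, Measure.smul_apply, withDensity_apply _ hSm, smul_eq_mul]
    _ ≤ (ENNReal.ofReal (Real.exp (-(β * N))))⁻¹ * _ :=
        mul_le_mul' (ENNReal.inv_le_inv.2 hZ) hSle
    _ = _ := by
        rw [← ENNReal.ofReal_inv_of_pos (Real.exp_pos _), ← Real.exp_neg, neg_neg,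
          ← ENNReal.ofReal_mul (Real.exp_pos _).le, ← Real.exp_add]
        congr 2; ring

/-- The bound carries `2 ℰ(τ) - ℰ(2 τ)` rather than the regularized energy `ℰ(τ)`, because the cross
term involves the smearing of `μ - ν` alone, and its self-energy the smearing of both factors. -/
theorem limsup_log_gibbs_le {β : ℝ} (hβ : 0 < β) (hβ2 : β < 2) (μ ν : Measure Square)
    [IsProbabilityMeasure μ] [IsProbabilityMeasure ν] {τ : ℝ} (hτ : 0 < τ) :
    limsup (fun ε : ℝ => limsup (fun N : ℕ => ((1 / (N : ℝ) ^ 2 : ℝ) : EReal) *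
        ENNReal.log (gibbs β N (nearEvent N μ ν ε))) atTop) (𝓝[>] (0 : ℝ))
      ≤ ((-(β / 2) * (2 * chargeEnergy μ ν τ - chargeEnergy μ ν (τ + τ)) : ℝ) : EReal) := by
  obtain ⟨C, hC0, hC⟩ := exists_lintegral_dist_rpow_le hβ2
  obtain ⟨L, hL, hlip, hb⟩ := exists_chargePotential_lipschitz μ ν hτ
  -- The smearing parameter `η` is taken equal to the radius `ε` of the ball.
  set g : ℝ → ℝ := fun ε => -(β / 2) * (2 * (chargeEnergy μ ν τ - L * ε)
    - (chargeEnergy μ ν (τ + τ) + 4 * ε / τ + 2 * ε)) with hg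
  have hinner : ∀ ε : ℝ, 0 < ε → limsup (fun N : ℕ => ((1 / (N : ℝ) ^ 2 : ℝ) : EReal) *
        ENNReal.log (gibbs β N (nearEvent N μ ν ε))) atTop ≤ ((g ε : ℝ) : EReal) := by
    intro ε hε
    set a : ℕ → ℝ := fun N => g ε + (β + β * logKernel (2 * ε) + Real.log C) * ((N : ℝ))⁻¹
      + Real.log 2 * ((N : ℝ)⁻¹ * (N : ℝ)⁻¹) + Real.log N / N with ha
    have hN : Tendsto (fun N : ℕ => ((N : ℝ))⁻¹) atTop (𝓝 0) := tendsto_inv_atTop_nhds_zero_nat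
    have hlogN : Tendsto (fun N : ℕ => Real.log N / N) atTop (𝓝 0) :=
      (Real.isLittleO_log_id_atTop.tendsto_div_nhds_zero).comp tendsto_natCast_atTop_atTop
    have hlim : Tendsto a atTop (𝓝 (g ε)) := by
      have := ((tendsto_const_nhds (x := g ε)).add
        (hN.const_mul (β + β * logKernel (2 * ε) + Real.log C))).add
          ((hN.mul hN).const_mul (Real.log 2)) |>.add hlogN
      simpa using this
    have hlim' : Tendsto (fun N => ((a N : ℝ) : EReal)) atTop (𝓝 ((g ε : ℝ) : EReal)) :=
      (continuous_coe_real_ereal.tendsto _).comp hlim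
    rw [← hlim'.limsup_eq]
    refine limsup_le_limsup ?_
    filter_upwards [eventually_ge_atTop 1] with N hN1
    have hN0 : (0 : ℝ) < N := by exact_mod_cast hN1
    have h1 := gibbs_nearEvent_le hβ hβ2 hC0 hC μ ν hτ hε hL hlip hb ε hN1
    have h2 := ENNReal.log_monotone h1
    rw [ENNReal.log_ofReal_of_pos (Real.exp_pos _), Real.log_exp] at h2
    refine (mul_le_mul_of_nonneg_left h2 (by
      rw [EReal.coe_nonneg]; positivity)).trans (le_of_eq ?_)
    rw [← EReal.coe_mul]
    congr 1
    simp only [ha, hg]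
    field_simp
    ring
  have hglim : Tendsto (fun ε => ((g ε : ℝ) : EReal)) (𝓝[>] (0 : ℝ)) (𝓝 ((g 0 : ℝ) : EReal)) := by
    have : Continuous g := by simp only [hg]; fun_prop
    exact ((continuous_coe_real_ereal.comp this).tendsto 0).mono_left nhdsWithin_le_nhds
  have h0 : g 0 = -(β / 2) * (2 * chargeEnergy μ ν τ - chargeEnergy μ ν (τ + τ)) := by
    simp [hg]
  rw [← h0, ← hglim.limsup_eq]
  refine limsup_le_limsup ?_
  filter_upwards [self_mem_nhdsWithin] with ε hε using hinner ε hε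

theorem abs_chargeEnergy_le (μ ν : Measure Square) [IsProbabilityMeasure μ]
    [IsProbabilityMeasure ν] {τ : ℝ} (hτ : 0 < τ) : |chargeEnergy μ ν τ| ≤ 2 / τ := by
  have hpot : ∀ (ρ : Measure Square) [IsProbabilityMeasure ρ] (x : Square),
      logKernel (τ + 2) ≤ logPotential ρ τ x.1 ∧ logPotential ρ τ x.1 ≤ logKernel τ := by
    intro ρ _ x
    have hi := integrable_logKernel ρ hτ x.1
    constructor
    · have := integral_mono (μ := ρ) (integrable_const (logKernel (τ + 2))) hi fun y =>
        logKernel_anti (by positivity) (by linarith [norm_sub_sq_le_two x y])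
      simpa [logPotential] using this
    · have := integral_mono (μ := ρ) hi (integrable_const (logKernel τ)) fun y =>
        logKernel_anti hτ (by linarith [sq_nonneg ‖x.1 - y.1‖])
      simpa [logPotential] using this
  have h1 := logKernel_sub_le hτ zero_le_two
  have h2 : (2 : ℝ) / (2 * τ) = 1 / τ := by field_simp
  have hψ : ∀ x : Square, ‖chargePotential μ ν τ x.1‖ ≤ 1 / τ := by
    intro x
    have h3 := hpot μ x
    have h4 := hpot ν x
    rw [Real.norm_eq_abs, abs_le]
    simp only [chargePotential]
    constructor <;> linarith
  have h5 := norm_integral_le_of_norm_le_const (μ := μ) (Eventually.of_forall hψ)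
  have h6 := norm_integral_le_of_norm_le_const (μ := ν) (Eventually.of_forall hψ)
  simp only [probReal_univ, mul_one, Real.norm_eq_abs] at h5 h6
  have h7 := abs_le.1 h5
  have h8 := abs_le.1 h6
  have h9 : 2 / τ = 1 / τ + 1 / τ := by ring
  rw [h9, abs_le]
  simp only [chargeEnergy]
  constructor <;> linarith

/-- Iterating `f τ ≤ (M + f (2 τ)) / 2` along `τ, 2 τ, 4 τ, …` gives `f τ ≤ M`. -/
theorem chargeEnergy_le_of_forall (μ ν : Measure Square) [IsProbabilityMeasure μ]
    [IsProbabilityMeasure ν] {M : ℝ}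
    (h : ∀ τ : ℝ, 0 < τ → 2 * chargeEnergy μ ν τ - chargeEnergy μ ν (τ + τ) ≤ M) {τ : ℝ}
    (hτ : 0 < τ) : chargeEnergy μ ν τ ≤ M := by
  have hk : ∀ k : ℕ, chargeEnergy μ ν τ - M ≤ (chargeEnergy μ ν (2 ^ k * τ) - M) * (1 / 2) ^ k := by
    intro k
    induction k with
    | zero => simp
    | succ k ih =>
      have h1 := h (2 ^ k * τ) (by positivity)
      have h2 : 2 ^ k * τ + 2 ^ k * τ = 2 ^ (k + 1) * τ := by ring
      rw [h2] at h1
      have h3 : (chargeEnergy μ ν (2 ^ k * τ) - M)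
          ≤ (chargeEnergy μ ν (2 ^ (k + 1) * τ) - M) * (1 / 2) := by linarith
      calc _ ≤ _ := ih
        _ ≤ (chargeEnergy μ ν (2 ^ (k + 1) * τ) - M) * (1 / 2) * (1 / 2) ^ k := by gcongr
        _ = _ := by rw [pow_succ']; ring
  have hk' : ∀ k : ℕ, chargeEnergy μ ν τ - M ≤ (2 / τ + |M|) * (1 / 2) ^ k := by
    intro k
    refine (hk k).trans ?_
    gcongr
    have h1 := (abs_le.1 (abs_chargeEnergy_le μ ν (τ := 2 ^ k * τ) (by positivity))).2
    have h2 : 2 / (2 ^ k * τ) ≤ 2 / τ := by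
      gcongr
      exact le_mul_of_one_le_left hτ.le (one_le_pow₀ one_le_two)
    linarith [neg_abs_le M]
  have hlim : Tendsto (fun k : ℕ => (2 / τ + |M|) * (1 / 2 : ℝ) ^ k) atTop (𝓝 0) := by
    have := (tendsto_pow_atTop_nhds_zero_of_lt_one (r := (1 / 2 : ℝ)) (by norm_num)
      (by norm_num)).const_mul (2 / τ + |M|)
    simpa using this
  linarith [ge_of_tendsto' hlim hk']

/-! ### Electric fields in the Hilbert space `L²` -/

/-- Riesz representation along a linear map: a functional bounded by `‖T v‖` is an inner product with
`T v`. -/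
theorem exists_inner_eq_of_bound {V F : Type*} [AddCommGroup V] [Module ℝ V]
    [NormedAddCommGroup F] [InnerProductSpace ℝ F] [CompleteSpace F] (T : V →ₗ[ℝ] F)
    (l : V →ₗ[ℝ] ℝ) {C : ℝ} (hC : 0 ≤ C) (h : ∀ v, |l v| ≤ C * ‖T v‖) :
    ∃ w : F, ‖w‖ ≤ C ∧ ∀ v, inner ℝ (T v) w = l v := by
  have hker : LinearMap.ker T ≤ LinearMap.ker l := by
    intro v hv
    have h1 := h v
    rw [LinearMap.mem_ker.1 hv, norm_zero, mul_zero] at h1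
    exact LinearMap.mem_ker.2 (abs_nonpos_iff.1 h1)
  let f : LinearMap.range T →ₗ[ℝ] ℝ :=
    (Submodule.liftQ _ l hker).comp T.quotKerEquivRange.symm.toLinearMap
  have hf : ∀ v, f ⟨T v, v, rfl⟩ = l v := by
    intro v
    have : T.quotKerEquivRange.symm ⟨T v, v, rfl⟩ = Submodule.Quotient.mk v := by
      rw [LinearEquiv.symm_apply_eq]; rfl
    simp only [f, LinearMap.comp_apply, LinearEquiv.coe_coe, this]
    exact Submodule.liftQ_apply _ _ _
  have hbound : ∀ x : LinearMap.range T, ‖f x‖ ≤ C * ‖x‖ := by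
    rintro ⟨_, v, rfl⟩
    rw [hf v]
    exact h v
  obtain ⟨g, hg, hgn⟩ := exists_extension_norm_eq _ (f.mkContinuous C hbound)
  refine ⟨(InnerProductSpace.toDual ℝ F).symm g, ?_, fun v => ?_⟩
  · rw [LinearIsometryEquiv.norm_map, hgn]
    exact LinearMap.mkContinuous_norm_le _ hC _
  · rw [real_inner_comm, InnerProductSpace.toDual_symm_apply]
    have := hg ⟨T v, v, rfl⟩
    simp only at this
    rw [this, LinearMap.mkContinuous_apply, hf]

/-- The space of smooth compactly supported test functions on the plane. -/
def testFunctions : Submodule ℝ (Plane → ℝ) where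
  carrier := {φ | ContDiff ℝ ∞ φ ∧ HasCompactSupport φ}
  add_mem' h h' := ⟨h.1.add h'.1, h.2.add h'.2⟩
  zero_mem' := ⟨contDiff_const, HasCompactSupport.zero⟩
  smul_mem' c _ h := ⟨contDiff_const.smul h.1, h.2.smul_left (f := fun _ => c)⟩

/-- The gradient of a function, through the Riesz identification of the plane with its dual. -/
def grad (φ : Plane → ℝ) (x : Plane) : Plane :=
  (InnerProductSpace.toDual ℝ Plane).symm (fderiv ℝ φ x)

theorem inner_grad (φ : Plane → ℝ) (x v : Plane) : inner ℝ (grad φ x) v = fderiv ℝ φ x v :=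
  InnerProductSpace.toDual_symm_apply

theorem memLp_grad {φ : Plane → ℝ} (hφ : φ ∈ testFunctions) : MemLp (grad φ) 2 volume := by
  have hc : Continuous (grad φ) :=
    (InnerProductSpace.toDual ℝ Plane).symm.continuous.comp (hφ.1.continuous_fderiv (by simp))
  refine hc.memLp_of_hasCompactSupport ?_
  have h := hφ.2.fderiv (𝕜 := ℝ)
  exact h.comp_left (g := (InnerProductSpace.toDual ℝ Plane).symm) (map_zero _)

/-- The gradient as a linear map from test functions to `L²` fields. -/
def gradLp : testFunctions →ₗ[ℝ] Lp Plane 2 (volume : Measure Plane) where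
  toFun φ := (memLp_grad φ.2).toLp _
  map_add' φ ψ := by
    rw [← MemLp.toLp_add]
    refine MemLp.toLp_congr _ _ (Eventually.of_forall fun x => ?_)
    have h1 := (φ.2.1.differentiable (by simp)).differentiableAt (x := x)
    have h2 := (ψ.2.1.differentiable (by simp)).differentiableAt (x := x)
    simp only [grad, Pi.add_apply, Submodule.coe_add, fderiv_add h1 h2, map_add]
  map_smul' c φ := by
    rw [RingHom.id_apply, ← MemLp.toLp_const_smul]
    refine MemLp.toLp_congr _ _ (Eventually.of_forall fun x => ?_)
    have h1 := (φ.2.1.differentiable (by simp)).differentiableAt (x := x)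
    simp only [grad, Pi.smul_apply, Submodule.coe_smul, fderiv_const_smul h1]
    rw [map_smulₛₗ, conj_trivial]

theorem inner_gradLp (φ : testFunctions) {E : Plane → Plane} (hE : MemLp E 2 volume) :
    inner ℝ (gradLp φ) (hE.toLp E) = ∫ x, fderiv ℝ φ.1 x (E x) := by
  rw [L2.inner_def]
  refine integral_congr_ae ?_
  filter_upwards [(memLp_grad φ.2).coeFn_toLp, hE.coeFn_toLp] with x h1 h2
  rw [h2, ← inner_grad]
  congr 1

theorem fieldEnergy_eq {E : Plane → Plane} (hE : MemLp E 2 volume) :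
    fieldEnergy E = ENNReal.ofReal (‖hE.toLp E‖ ^ 2) := by
  have h := eLpNorm_nnreal_pow_eq_lintegral (f := E) (μ := (volume : Measure Plane)) (p := 2)
    two_ne_zero
  simp only [ENNReal.coe_ofNat, NNReal.coe_ofNat, ENNReal.rpow_ofNat] at h
  rw [fieldEnergy, ← h, Lp.norm_toLp, ENNReal.ofReal_pow ENNReal.toReal_nonneg,
    ENNReal.ofReal_toReal hE.2.ne]

theorem integrable_testFunction (μ : Measure Square) [IsFiniteMeasure μ] {φ : Plane → ℝ}
    (hφ : φ ∈ testFunctions) : Integrable (fun x : Square => φ x.1) μ := by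
  obtain ⟨C, hC⟩ := hφ.2.exists_bound_of_continuous hφ.1.continuous
  exact Integrable.of_bound
    (hφ.1.continuous.comp continuous_subtype_val).measurable.aestronglyMeasurable C
    (Eventually.of_forall fun x => hC x.1)

/-- The distribution `2 π (μ - ν)`, as a functional on test functions. -/
def chargeFunctional (μ ν : Measure Square) [IsFiniteMeasure μ] [IsFiniteMeasure ν] :
    testFunctions →ₗ[ℝ] ℝ where
  toFun φ := 2 * Real.pi * (∫ x : Square, φ.1 x.1 ∂μ - ∫ x : Square, φ.1 x.1 ∂ν)
  map_add' φ ψ := by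
    simp only [Submodule.coe_add, Pi.add_apply]
    rw [integral_add (integrable_testFunction μ φ.2) (integrable_testFunction μ ψ.2),
      integral_add (integrable_testFunction ν φ.2) (integrable_testFunction ν ψ.2)]
    ring
  map_smul' c φ := by
    simp only [Submodule.coe_smul, Pi.smul_apply, smul_eq_mul, integral_const_mul,
      RingHom.id_apply]
    ring

theorem isElectricField_iff (μ ν : Measure Square) [IsFiniteMeasure μ] [IsFiniteMeasure ν]
    {E : Plane → Plane} (hE : MemLp E 2 volume) : IsElectricField μ ν E ↔
      ∀ φ : testFunctions, inner ℝ (gradLp φ) (hE.toLp E) = chargeFunctional μ ν φ := by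
  constructor
  · intro h φ
    rw [inner_gradLp]
    exact h.2 φ.1 φ.2.1 φ.2.2
  · intro h
    refine ⟨hE, fun φ h1 h2 => ?_⟩
    have := h ⟨φ, h1, h2⟩
    rw [inner_gradLp] at this
    exact this

theorem isElectricField_coeFn (μ ν : Measure Square) [IsFiniteMeasure μ] [IsFiniteMeasure ν]
    {v : Lp Plane 2 (volume : Measure Plane)}
    (hv : ∀ φ : testFunctions, inner ℝ (gradLp φ) v = chargeFunctional μ ν φ) :
    IsElectricField μ ν v ∧ fieldEnergy v = ENNReal.ofReal (‖v‖ ^ 2) := by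
  have h := fieldEnergy_eq (Lp.memLp v)
  rw [Lp.toLp_coeFn] at h
  refine ⟨(isElectricField_iff μ ν (Lp.memLp v)).2 ?_, h⟩
  rw [Lp.toLp_coeFn]
  exact hv

/-- The fields with the prescribed divergence form a closed convex set, so one of them has least
norm. -/
theorem exists_minimizer (μ ν : Measure Square) [IsFiniteMeasure μ] [IsFiniteMeasure ν]
    (h : H μ ν < ⊤) : ∃ E, IsElectricField μ ν E ∧ fieldEnergy E = H μ ν := by
  obtain ⟨E₀, hE₀⟩ := iInf_lt_iff.1 h
  obtain ⟨hf₀, -⟩ := iInf_lt_iff.1 hE₀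
  set K : Set (Lp Plane 2 (volume : Measure Plane)) :=
    {v | ∀ φ : testFunctions, inner ℝ (gradLp φ) v = chargeFunctional μ ν φ} with hK
  have hne : K.Nonempty := ⟨hf₀.1.toLp E₀, (isElectricField_iff μ ν hf₀.1).1 hf₀⟩
  have hcl : IsClosed K := by
    have : K = ⋂ φ : testFunctions, {v | inner ℝ (gradLp φ) v = chargeFunctional μ ν φ} := by
      ext v; simp [hK]
    rw [this]
    exact isClosed_iInter fun φ => isClosed_eq (by fun_prop) continuous_const
  have hconv : Convex ℝ K := by
    intro v hv w hw a b _ _ hab φ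
    rw [inner_add_right, inner_smul_right, inner_smul_right, hv φ, hw φ, ← add_mul, hab, one_mul]
  obtain ⟨v, hvK, hv⟩ := exists_norm_eq_iInf_of_complete_convex hne hcl.isComplete hconv 0
  obtain ⟨hvE, hven⟩ := isElectricField_coeFn μ ν hvK
  refine ⟨v, hvE, le_antisymm (le_iInf fun E => le_iInf fun hE => ?_)
    (iInf_le_of_le _ (iInf_le_of_le hvE le_rfl))⟩
  rw [hven, fieldEnergy_eq hE.1]
  refine ENNReal.ofReal_le_ofReal ?_
  have hle : ‖v‖ ≤ ‖hE.1.toLp E‖ := by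
    have hmem : hE.1.toLp E ∈ K := (isElectricField_iff μ ν hE.1).1 hE
    have hbdd : BddBelow (Set.range fun w : K => ‖(0 : Lp Plane 2 (volume : Measure Plane)) - w‖) :=
      ⟨0, by rintro _ ⟨w, rfl⟩; exact norm_nonneg _⟩
    have := ciInf_le hbdd ⟨_, hmem⟩
    rw [← hv] at this
    simpa using this
  gcongr

theorem H_le_of_bound (μ ν : Measure Square) [IsFiniteMeasure μ] [IsFiniteMeasure ν] {C : ℝ}
    (hC : 0 ≤ C) (h : ∀ φ : testFunctions, |chargeFunctional μ ν φ| ≤ C * ‖gradLp φ‖) :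
    H μ ν ≤ ENNReal.ofReal (C ^ 2) := by
  obtain ⟨v, hvC, hv⟩ := exists_inner_eq_of_bound gradLp (chargeFunctional μ ν) hC h
  obtain ⟨hvE, hven⟩ := isElectricField_coeFn μ ν hv
  refine iInf_le_of_le _ (iInf_le_of_le hvE ?_)
  rw [hven]
  exact ENNReal.ofReal_le_ofReal (by gcongr)

/-- A finite measure on the square is determined by the integrals of test functions. -/
theorem measure_eq_of_testFunctions (μ ν : Measure Square) [IsFiniteMeasure μ]
    [IsFiniteMeasure ν] (h : ∀ φ ∈ testFunctions,
      ∫ x : Square, φ x.1 ∂μ = ∫ x : Square, φ x.1 ∂ν) : μ = ν := by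
  have hopen : ∀ U : Set Plane, IsOpen U → Bornology.IsBounded U →
      μ (Subtype.val ⁻¹' U) = ν (Subtype.val ⁻¹' U) := by
    intro U hU hUb
    obtain ⟨f, hfs, hfc, hfr⟩ := hU.exists_contDiff_support_eq (n := ⊤)
    set φ : ℕ → Plane → ℝ := fun n x => Real.smoothTransition (n * f x) with hφ
    have hf0 : ∀ x, 0 ≤ f x := fun x => (hfr ⟨x, rfl⟩).1
    have hφm : ∀ n, φ n ∈ testFunctions := by
      intro n
      refine ⟨Real.smoothTransition.contDiff.comp (contDiff_const.mul hfc), ?_⟩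
      refine HasCompactSupport.of_support_subset_isCompact hUb.isCompact_closure ?_
      intro x hx
      refine subset_closure ?_
      rw [← hfs]
      intro h0
      apply hx
      simp [hφ, h0]
    have hlim : ∀ (ρ : Measure Square) [IsFiniteMeasure ρ],
        Tendsto (fun n => ∫ x : Square, φ n x.1 ∂ρ) atTop
          (𝓝 (ρ.real (Subtype.val ⁻¹' U))) := by
      intro ρ _
      have hUm : MeasurableSet (Subtype.val ⁻¹' U : Set Square) :=
        measurable_subtype_coe hU.measurableSet
      rw [← integral_indicator_one hUm]
      refine tendsto_integral_of_dominated_convergence (fun _ => 1)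
        (fun n => (integrable_testFunction ρ (hφm n)).aestronglyMeasurable)
        (integrable_const _) (fun n => Eventually.of_forall fun x => ?_)
        (Eventually.of_forall fun x => ?_)
      · rw [Real.norm_eq_abs, abs_of_nonneg (Real.smoothTransition.nonneg _)]
        exact Real.smoothTransition.le_one _
      · by_cases hx : x.1 ∈ U
        · have hpos : 0 < f x.1 := by
            refine lt_of_le_of_ne (hf0 _) fun h0 => ?_
            rw [← hfs] at hx
            exact hx h0.symm
          rw [Set.indicator_of_mem (by exact hx)]
          refine tendsto_const_nhds.congr' ?_
          obtain ⟨m, hm⟩ := exists_nat_ge (1 / f x.1)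
          filter_upwards [eventually_ge_atTop m] with n hn
          refine (Real.smoothTransition.one_of_one_le ?_).symm
          rw [div_le_iff₀ hpos] at hm
          have : (m : ℝ) ≤ n := by exact_mod_cast hn
          nlinarith
        · have h0 : f x.1 = 0 := by
            by_contra h0
            exact hx (hfs ▸ h0)
          rw [Set.indicator_of_notMem (by exact hx)]
          simp [hφ, h0]
    have h1 := hlim μ
    simp only [h _ (hφm _)] at h1
    have h2 := tendsto_nhds_unique h1 (hlim ν)
    rwa [measureReal_eq_measureReal_iff] at h2
  have hball : ∀ U : Set Plane,
      (Subtype.val ⁻¹' U : Set Square) = Subtype.val ⁻¹' (U ∩ Metric.ball 0 3) := by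
    intro U
    ext x
    have := norm_le_two x
    simp only [Set.mem_preimage, Set.mem_inter_iff, mem_ball_zero_iff]
    exact ⟨fun h => ⟨h, by linarith⟩, fun h => h.1⟩
  have hopen' : ∀ U : Set Plane, IsOpen U → μ (Subtype.val ⁻¹' U) = ν (Subtype.val ⁻¹' U) := by
    intro U hU
    rw [hball]
    exact hopen _ (hU.inter Metric.isOpen_ball) (Metric.isBounded_ball.subset Set.inter_subset_right)
  refine ext_of_generate_finite {s : Set Square | IsOpen s}
    (BorelSpace.measurable_eq (α := Square)) isPiSystem_isOpen ?_ ?_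
  · intro s hs
    obtain ⟨U, hU, rfl⟩ := isOpen_induced_iff.1 hs
    exact hopen' U hU
  · simpa using hopen' Set.univ isOpen_univ

theorem H_eq_zero_iff (μ ν : Measure Square) [IsFiniteMeasure μ] [IsFiniteMeasure ν] :
    H μ ν = 0 ↔ μ = ν := by
  constructor
  · intro h
    obtain ⟨E, hE, hE0⟩ := exists_minimizer μ ν (by rw [h]; exact ENNReal.zero_lt_top)
    rw [h, fieldEnergy_eq hE.1, ENNReal.ofReal_eq_zero] at hE0
    have h0 : hE.1.toLp E = 0 := by
      have : ‖hE.1.toLp E‖ = 0 := by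
        have := norm_nonneg (hE.1.toLp E)
        nlinarith
      exact norm_eq_zero.1 this
    refine measure_eq_of_testFunctions μ ν fun φ hφ => ?_
    have h1 := (isElectricField_iff μ ν hE.1).1 hE ⟨φ, hφ⟩
    rw [h0, inner_zero_right] at h1
    have h2 : 2 * Real.pi * (∫ x : Square, φ x.1 ∂μ - ∫ x : Square, φ x.1 ∂ν) = 0 := h1.symm
    have h3 : (2 * Real.pi) ≠ 0 := by positivity
    linarith [(mul_eq_zero.1 h2).resolve_left h3]
  · rintro rfl
    have hf : IsElectricField μ μ (0 : Plane → Plane) :=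
      ⟨MemLp.zero, fun φ _ _ => by simp⟩
    refine le_antisymm (iInf_le_of_le _ (iInf_le_of_le hf ?_)) zero_le
    simp [fieldEnergy]

/-! ### The logarithm as the fundamental solution of the Laplacian -/

/-- The partial derivative in the `k`-th coordinate direction. -/
def partialDeriv (k : Fin 2) (f : Plane → ℝ) (x : Plane) : ℝ :=
  fderiv ℝ f x (EuclideanSpace.single k 1)

/-- The Laplacian `∂₀² + ∂₁²`. -/
def planeLaplacian (f : Plane → ℝ) (x : Plane) : ℝ :=
  ∑ k, partialDeriv k (partialDeriv k f) x

theorem contDiff_partialDeriv {f : Plane → ℝ} {m n : WithTop ℕ∞} (hf : ContDiff ℝ n f)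
    (hmn : m + 1 ≤ n) (k : Fin 2) : ContDiff ℝ m (partialDeriv k f) :=
  (hf.fderiv_right hmn).clm_apply contDiff_const

theorem hasCompactSupport_partialDeriv {f : Plane → ℝ} (hf : HasCompactSupport f) (k : Fin 2) :
    HasCompactSupport (partialDeriv k f) :=
  hf.fderiv_apply ℝ _

theorem integral_mul_partialDeriv {f g : Plane → ℝ} (hf : ContDiff ℝ 1 f) (hg : ContDiff ℝ 1 g)
    (hgc : HasCompactSupport g) (k : Fin 2) :
    ∫ x, f x * partialDeriv k g x = -∫ x, partialDeriv k f x * g x := by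
  have hf' : Continuous (partialDeriv k f) :=
    (contDiff_partialDeriv (m := 0) hf (by simp) k).continuous
  have hg' : Continuous (partialDeriv k g) :=
    (contDiff_partialDeriv (m := 0) hg (by simp) k).continuous
  refine integral_mul_fderiv_eq_neg_fderiv_mul_of_integrable ?_ ?_ ?_
    (fun x _ => (hf.differentiable one_ne_zero).differentiableAt)
    (fun x _ => (hg.differentiable one_ne_zero).differentiableAt)
  · exact (hf'.mul hg.continuous).integrable_of_hasCompactSupport hgc.mul_left
  · exact (hf.continuous.mul hg').integrable_of_hasCompactSupport
      (hasCompactSupport_partialDeriv hgc k).mul_left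
  · exact (hf.continuous.mul hg.continuous).integrable_of_hasCompactSupport hgc.mul_left

theorem continuous_planeLaplacian {f : Plane → ℝ} (hf : ContDiff ℝ 2 f) :
    Continuous (planeLaplacian f) :=
  continuous_finsetSum _ fun k _ =>
    (contDiff_partialDeriv (m := 0) (n := 1) (contDiff_partialDeriv hf (by norm_num) k)
      (by simp) k).continuous

theorem planeLaplacian_eq_zero_of_notMem_tsupport {f : Plane → ℝ} {x : Plane}
    (hx : x ∉ tsupport f) : planeLaplacian f x = 0 := by
  refine Finset.sum_eq_zero fun k _ => ?_
  have h1 : tsupport (partialDeriv k (partialDeriv k f)) ⊆ tsupport f :=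
    (tsupport_fderiv_apply_subset ℝ _).trans (tsupport_fderiv_apply_subset ℝ _)
  exact image_eq_zero_of_notMem_tsupport fun h => hx (h1 h)

theorem hasCompactSupport_planeLaplacian {f : Plane → ℝ} (hf : HasCompactSupport f) :
    HasCompactSupport (planeLaplacian f) :=
  HasCompactSupport.intro hf fun _ hx => planeLaplacian_eq_zero_of_notMem_tsupport hx

/-- Green's identity, with the boundary terms absent by compact support. -/
theorem integral_mul_planeLaplacian {f g : Plane → ℝ} (hf : ContDiff ℝ 2 f) (hg : ContDiff ℝ 2 g)
    (hgc : HasCompactSupport g) :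
    ∫ x, f x * planeLaplacian g x = ∫ x, planeLaplacian f x * g x ∧
      ∫ x, f x * planeLaplacian g x = -∑ k, ∫ x, partialDeriv k f x * partialDeriv k g x := by
  have hf1 : ∀ k, ContDiff ℝ 1 (partialDeriv k f) := contDiff_partialDeriv hf (by norm_num)
  have hg1 : ∀ k, ContDiff ℝ 1 (partialDeriv k g) := contDiff_partialDeriv hg (by norm_num)
  have hf2 : ∀ k, Continuous (partialDeriv k (partialDeriv k f)) := fun k =>
    (contDiff_partialDeriv (m := 0) (hf1 k) (by simp) k).continuous
  have hg2 : ∀ k, Continuous (partialDeriv k (partialDeriv k g)) := fun k =>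
    (contDiff_partialDeriv (m := 0) (hg1 k) (by simp) k).continuous
  have hgk := hasCompactSupport_partialDeriv hgc
  have h1 : ∫ x, f x * planeLaplacian g x
      = -∑ k, ∫ x, partialDeriv k f x * partialDeriv k g x := by
    simp only [planeLaplacian, Finset.mul_sum]
    rw [integral_finsetSum, ← Finset.sum_neg_distrib]
    · exact Finset.sum_congr rfl fun k _ => integral_mul_partialDeriv (hf.of_le (by norm_num))
        (hg1 k) (hgk k) k
    · exact fun k _ => (hf.continuous.mul (hg2 k)).integrable_of_hasCompactSupport
        (hasCompactSupport_partialDeriv (hgk k) k).mul_left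
  refine ⟨?_, h1⟩
  rw [h1]
  simp only [planeLaplacian, Finset.sum_mul]
  rw [integral_finsetSum, ← Finset.sum_neg_distrib]
  · refine Finset.sum_congr rfl fun k _ => ?_
    rw [integral_mul_partialDeriv (hf1 k) (hg.of_le (by norm_num)) hgc k, neg_neg]
  · exact fun k _ => ((hf2 k).mul hg.continuous).integrable_of_hasCompactSupport hgc.mul_left

theorem contDiff_logKernel {τ : ℝ} (hτ : 0 < τ) (y : Plane) {n : WithTop ℕ∞} :
    ContDiff ℝ n fun x : Plane => logKernel (‖x - y‖ ^ 2 + τ) := by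
  have h1 : ContDiff ℝ n fun x : Plane => ‖x - y‖ ^ 2 + τ :=
    ((contDiff_id.sub contDiff_const).norm_sq ℝ).add contDiff_const
  exact contDiff_const.mul (h1.log fun x => by positivity)

theorem hasFDerivAt_norm_sub_sq_add (y : Plane) (τ : ℝ) (x : Plane) :
    HasFDerivAt (fun x : Plane => ‖x - y‖ ^ 2 + τ) (2 • innerSL ℝ (x - y)) x := by
  have h := ((hasFDerivAt_id x).sub_const y).norm_sq.add_const τ
  simpa using h

theorem partialDeriv_logKernel {τ : ℝ} (hτ : 0 < τ) (y : Plane) (k : Fin 2) (x : Plane) :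
    partialDeriv k (fun x : Plane => logKernel (‖x - y‖ ^ 2 + τ)) x
      = -((x k - y k) * (‖x - y‖ ^ 2 + τ)⁻¹) := by
  have h0 : ‖x - y‖ ^ 2 + τ ≠ 0 := by positivity
  have h := ((hasFDerivAt_norm_sub_sq_add y τ x).log h0).const_mul (-(1 / 2) : ℝ)
  have h' : HasFDerivAt (fun x : Plane => logKernel (‖x - y‖ ^ 2 + τ)) _ x := h
  rw [partialDeriv, h'.fderiv]
  simp [EuclideanSpace.inner_single_right]
  ring

theorem partialDeriv_partialDeriv_logKernel {τ : ℝ} (hτ : 0 < τ) (y : Plane) (k : Fin 2)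
    (x : Plane) :
    partialDeriv k (partialDeriv k (fun x : Plane => logKernel (‖x - y‖ ^ 2 + τ))) x
      = -(‖x - y‖ ^ 2 + τ)⁻¹ + 2 * (x k - y k) ^ 2 * ((‖x - y‖ ^ 2 + τ)⁻¹) ^ 2 := by
  have h0 : ‖x - y‖ ^ 2 + τ ≠ 0 := by positivity
  have hf : partialDeriv k (fun x : Plane => logKernel (‖x - y‖ ^ 2 + τ))
      = fun x => -((x k - y k) * (‖x - y‖ ^ 2 + τ)⁻¹) := funext fun x =>
    partialDeriv_logKernel hτ y k x
  rw [hf]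
  have h1 : HasFDerivAt (fun x : Plane => x k - y k) (EuclideanSpace.proj k : Plane →L[ℝ] ℝ) x :=
    ((EuclideanSpace.proj k : Plane →L[ℝ] ℝ).hasFDerivAt (x := x)).sub_const (y k)
  have h2 := (hasDerivAt_inv h0).comp_hasFDerivAt x (hasFDerivAt_norm_sub_sq_add y τ x)
  have h3 := (h1.mul h2).neg
  have h3' : HasFDerivAt (fun x : Plane => -((x k - y k) * (‖x - y‖ ^ 2 + τ)⁻¹)) _ x := h3
  rw [partialDeriv, h3'.fderiv]
  simp [EuclideanSpace.inner_single_right]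
  ring

theorem planeLaplacian_logKernel {τ : ℝ} (hτ : 0 < τ) (y x : Plane) :
    planeLaplacian (fun x : Plane => logKernel (‖x - y‖ ^ 2 + τ)) x
      = -(2 * τ * ((‖x - y‖ ^ 2 + τ)⁻¹) ^ 2) := by
  simp only [planeLaplacian, partialDeriv_partialDeriv_logKernel hτ]
  have h0 : ‖x - y‖ ^ 2 + τ ≠ 0 := by positivity
  have h1 : ‖x - y‖ ^ 2 = (x 0 - y 0) ^ 2 + (x 1 - y 1) ^ 2 := by
    rw [EuclideanSpace.norm_sq_eq, Fin.sum_univ_two]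
    simp
  rw [Fin.sum_univ_two]
  field_simp
  rw [h1]; ring

/-- The kernel `-(2 π)⁻¹ Δ logKernel (|·|² + 1) = π⁻¹ (|·|² + 1)⁻²` has total mass `1`. -/
theorem integral_poisson :
    Integrable (fun z : Plane => ((‖z‖ ^ 2 + 1)⁻¹) ^ 2) ∧
      ∫ z : Plane, ((‖z‖ ^ 2 + 1)⁻¹) ^ 2 = Real.pi := by
  have hderiv : ∀ r ∈ Set.Ici (0 : ℝ), HasDerivAt (fun r : ℝ => -(1 / 2) * (r ^ 2 + 1)⁻¹)
      (r ^ 1 • ((r ^ 2 + 1)⁻¹) ^ 2) r := by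
    intro r _
    have h0 : r ^ 2 + 1 ≠ 0 := by positivity
    have h := (((hasDerivAt_pow 2 r).add_const 1).inv h0).const_mul (-(1 / 2) : ℝ)
    refine h.congr_deriv ?_
    simp
    field_simp
  have hlim : Tendsto (fun r : ℝ => -(1 / 2) * (r ^ 2 + 1)⁻¹) atTop (𝓝 0) := by
    have h1 : Tendsto (fun r : ℝ => r ^ 2 + 1) atTop atTop :=
      tendsto_atTop_add_const_right _ _ (tendsto_pow_atTop two_ne_zero)
    simpa using h1.inv_tendsto_atTop.const_mul (-(1 / 2) : ℝ)
  have hnn : ∀ r ∈ Set.Ioi (0 : ℝ), 0 ≤ r ^ 1 • ((r ^ 2 + 1)⁻¹) ^ 2 := fun r hr => by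
    have hr : 0 < r := hr
    simp only [smul_eq_mul]; positivity
  have hI := integral_Ioi_of_hasDerivAt_of_nonneg' hderiv hnn hlim
  have hi := integrableOn_Ioi_deriv_of_nonneg' hderiv hnn hlim
  have hdim : Module.finrank ℝ Plane = 2 := by simp
  constructor
  · rw [integrable_fun_norm_addHaar volume (f := fun r : ℝ => ((r ^ 2 + 1)⁻¹) ^ 2), hdim]
    exact hi
  · rw [integral_fun_norm_addHaar volume (fun r : ℝ => ((r ^ 2 + 1)⁻¹) ^ 2), hdim, hI,
      Measure.real, EuclideanSpace.volume_ball_fin_two]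
    simp [Real.pi_pos.le]
    ring

/-- The charge density `-(2 π)⁻¹ Δ φ` whose logarithmic potential is `φ`. -/
def chargeDensity (φ : Plane → ℝ) (x : Plane) : ℝ :=
  -(2 * Real.pi)⁻¹ * planeLaplacian φ x

/-- The regularized logarithmic potential of the density `-(2 π)⁻¹ Δ φ`. -/
def mollify (τ : ℝ) (φ : Plane → ℝ) (y : Plane) : ℝ :=
  ∫ x : Plane, chargeDensity φ x * logKernel (‖x - y‖ ^ 2 + τ)

theorem contDiff_two_of_mem {φ : Plane → ℝ} (hφ : φ ∈ testFunctions) : ContDiff ℝ 2 φ :=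
  hφ.1.of_le (by norm_cast)

theorem continuous_chargeDensity {φ : Plane → ℝ} (hφ : φ ∈ testFunctions) :
    Continuous (chargeDensity φ) :=
  continuous_const.mul (continuous_planeLaplacian (contDiff_two_of_mem hφ))

theorem hasCompactSupport_chargeDensity {φ : Plane → ℝ} (hφ : φ ∈ testFunctions) :
    HasCompactSupport (chargeDensity φ) :=
  (hasCompactSupport_planeLaplacian hφ.2).mul_left

theorem mollify_eq {φ : Plane → ℝ} (hφ : φ ∈ testFunctions) {τ : ℝ} (hτ : 0 < τ) (y : Plane) :
    mollify τ φ y = Real.pi⁻¹ * ∫ z : Plane, ((‖z‖ ^ 2 + 1)⁻¹) ^ 2 * φ (y + Real.sqrt τ • z) := by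
  have h1 := (integral_mul_planeLaplacian (contDiff_logKernel hτ y (n := 2))
    (contDiff_two_of_mem hφ) hφ.2).1
  simp only [planeLaplacian_logKernel hτ] at h1
  have h2 : mollify τ φ y = Real.pi⁻¹ * ∫ x : Plane, τ * ((‖x - y‖ ^ 2 + τ)⁻¹) ^ 2 * φ x := by
    have : ∀ x : Plane, chargeDensity φ x * logKernel (‖x - y‖ ^ 2 + τ)
        = -(2 * Real.pi)⁻¹ * (logKernel (‖x - y‖ ^ 2 + τ) * planeLaplacian φ x) := by
      intro x; simp only [chargeDensity]; ring
    simp only [mollify, this]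
    rw [integral_const_mul, h1, ← integral_const_mul, ← integral_const_mul]
    congr 1; ext x
    field_simp
  have hs : 0 < Real.sqrt τ := Real.sqrt_pos.2 hτ
  have hss : Real.sqrt τ ^ 2 = τ := Real.sq_sqrt hτ.le
  have h3 : ∫ x : Plane, τ * ((‖x - y‖ ^ 2 + τ)⁻¹) ^ 2 * φ x
      = ∫ x : Plane, τ * ((‖x‖ ^ 2 + τ)⁻¹) ^ 2 * φ (y + x) := by
    rw [← integral_add_left_eq_self _ y]
    simp
  have h4 := Measure.integral_comp_smul (volume : Measure Plane)
    (fun x : Plane => τ * ((‖x‖ ^ 2 + τ)⁻¹) ^ 2 * φ (y + x)) (Real.sqrt τ)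
  have hdim : Module.finrank ℝ Plane = 2 := by simp
  rw [hdim, hss, abs_of_pos (inv_pos.2 hτ), smul_eq_mul, eq_inv_mul_iff_mul_eq₀ hτ.ne'] at h4
  rw [h2, h3, ← h4, ← integral_const_mul]
  congr 2; ext z
  rw [norm_smul, Real.norm_eq_abs, abs_of_pos hs, mul_pow, hss]
  have h0 : ‖z‖ ^ 2 + 1 ≠ 0 := by positivity
  have h5 : τ * ‖z‖ ^ 2 + τ = τ * (‖z‖ ^ 2 + 1) := by ring
  rw [h5]
  field_simp

theorem exists_bound_of_mem {φ : Plane → ℝ} (hφ : φ ∈ testFunctions) :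
    ∃ B, ∀ x, ‖φ x‖ ≤ B :=
  hφ.2.exists_bound_of_continuous hφ.1.continuous

theorem abs_mollify_le {φ : Plane → ℝ} (hφ : φ ∈ testFunctions) {B : ℝ} (hB : ∀ x, ‖φ x‖ ≤ B)
    {τ : ℝ} (hτ : 0 < τ) (y : Plane) : ‖mollify τ φ y‖ ≤ B := by
  have h1 := norm_integral_le_of_norm_le (μ := (volume : Measure Plane))
    (f := fun z : Plane => ((‖z‖ ^ 2 + 1)⁻¹) ^ 2 * φ (y + Real.sqrt τ • z))
    (integral_poisson.1.mul_const B) (Eventually.of_forall fun z => by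
      rw [norm_mul, Real.norm_eq_abs, abs_of_nonneg (by positivity)]
      exact mul_le_mul_of_nonneg_left (hB _) (by positivity))
  rw [integral_mul_const, integral_poisson.2] at h1
  rw [mollify_eq hφ hτ, norm_mul, Real.norm_eq_abs, abs_of_pos (inv_pos.2 Real.pi_pos),
    inv_mul_le_iff₀ Real.pi_pos]
  exact h1

/-- As the regularization is removed, the potential of `-(2 π)⁻¹ Δ φ` tends to `φ`. -/
theorem tendsto_mollify {φ : Plane → ℝ} (hφ : φ ∈ testFunctions) (y : Plane) :
    Tendsto (fun n : ℕ => mollify (1 / ((n : ℝ) + 1)) φ y) atTop (𝓝 (φ y)) := by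
  obtain ⟨B, hB⟩ := exists_bound_of_mem hφ
  have hs : Tendsto (fun n : ℕ => Real.sqrt (1 / ((n : ℝ) + 1))) atTop (𝓝 0) := by
    have := (Real.continuous_sqrt.tendsto 0).comp (tendsto_one_div_add_atTop_nhds_zero_nat (𝕜 := ℝ))
    rwa [Real.sqrt_zero] at this
  have h1 := tendsto_integral_of_dominated_convergence (μ := (volume : Measure Plane))
    (F := fun (n : ℕ) (z : Plane) =>
      ((‖z‖ ^ 2 + 1)⁻¹) ^ 2 * φ (y + Real.sqrt (1 / ((n : ℝ) + 1)) • z))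
    (f := fun z => ((‖z‖ ^ 2 + 1)⁻¹) ^ 2 * φ y)
    (fun z => ((‖z‖ ^ 2 + 1)⁻¹) ^ 2 * B)
    (fun n => by
      have := hφ.1.continuous.measurable
      exact Measurable.aestronglyMeasurable (by fun_prop))
    (integral_poisson.1.mul_const B)
    (fun n => Eventually.of_forall fun z => by
      rw [norm_mul, Real.norm_eq_abs, abs_of_nonneg (by positivity)]
      exact mul_le_mul_of_nonneg_left (hB _) (by positivity))
    (Eventually.of_forall fun z => by
      refine Tendsto.const_mul _ ((hφ.1.continuous.tendsto y).comp ?_)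
      have := (hs.smul_const z).const_add y
      simpa using this)
  rw [integral_mul_const, integral_poisson.2] at h1
  have h2 := h1.const_mul Real.pi⁻¹
  rw [inv_mul_cancel_left₀ Real.pi_pos.ne'] at h2
  refine h2.congr fun n => ?_
  rw [mollify_eq hφ (by positivity)]

theorem integral_chargeDensity {φ : Plane → ℝ} (hφ : φ ∈ testFunctions) :
    ∫ x, chargeDensity φ x = 0 := by
  have h := (integral_mul_planeLaplacian (f := fun _ => (1 : ℝ)) contDiff_const
    (contDiff_two_of_mem hφ) hφ.2).2
  have h0 : ∀ k x, partialDeriv k (fun _ => (1 : ℝ)) x = 0 := fun k x => by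
    simp [partialDeriv]
  simp only [h0, one_mul, zero_mul, integral_zero, Finset.sum_const_zero, neg_zero] at h
  simp only [chargeDensity, integral_const_mul, h, mul_zero]

/-- The logarithmic energy of `-(2 π)⁻¹ Δ φ` is the Dirichlet energy of `φ` divided by `2 π`. -/
theorem integral_chargeDensity_mul {φ : Plane → ℝ} (hφ : φ ∈ testFunctions) :
    ∫ x, chargeDensity φ x * φ x = (2 * Real.pi)⁻¹ * ‖gradLp ⟨φ, hφ⟩‖ ^ 2 := by
  have h := (integral_mul_planeLaplacian (contDiff_two_of_mem hφ) (contDiff_two_of_mem hφ)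
    hφ.2).2
  have hp : ∀ k, Continuous (partialDeriv k φ) := fun k =>
    (contDiff_partialDeriv (m := 1) (contDiff_two_of_mem hφ) (by norm_num) k).continuous
  have h1 : ‖gradLp ⟨φ, hφ⟩‖ ^ 2 = ∑ k, ∫ x, partialDeriv k φ x * partialDeriv k φ x := by
    rw [← real_inner_self_eq_norm_sq]
    have h2 : inner ℝ (gradLp ⟨φ, hφ⟩) (gradLp ⟨φ, hφ⟩) = ∫ x, fderiv ℝ φ x (grad φ x) :=
      inner_gradLp ⟨φ, hφ⟩ (memLp_grad hφ)
    rw [h2, ← integral_finsetSum]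
    · refine integral_congr_ae (Eventually.of_forall fun x => ?_)
      have h3 : ∀ k, grad φ x k = partialDeriv k φ x := by
        intro k
        rw [partialDeriv, ← inner_grad, EuclideanSpace.inner_single_right]
        simp
      simp only
      rw [← inner_grad, real_inner_self_eq_norm_sq, EuclideanSpace.norm_sq_eq]
      refine Finset.sum_congr rfl fun k _ => ?_
      rw [h3, Real.norm_eq_abs, sq_abs, sq]
    · exact fun k _ => ((hp k).mul (hp k)).integrable_of_hasCompactSupport
        (hasCompactSupport_partialDeriv hφ.2 k).mul_left
  have h4 : ∀ x, chargeDensity φ x * φ x = -(2 * Real.pi)⁻¹ * (φ x * planeLaplacian φ x) := by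
    intro x; simp only [chargeDensity]; ring
  simp only [h4, integral_const_mul, h, h1]
  ring

/-- Positivity of the regularized energy of `μ - ν - s m`, where `m = -(2 π)⁻¹ Δ φ`. -/
theorem charge_minus_density_energy_nonneg (μ ν : Measure Square) [IsProbabilityMeasure μ]
    [IsProbabilityMeasure ν] {φ : Plane → ℝ} (hφ : φ ∈ testFunctions) {τ : ℝ} (hτ : 0 < τ)
    (s : ℝ) :
    0 ≤ chargeEnergy μ ν τ
      - 2 * s * (∫ y : Square, mollify τ φ y.1 ∂μ - ∫ y : Square, mollify τ φ y.1 ∂ν)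
      + s ^ 2 * ∫ x, chargeDensity φ x * mollify τ φ x := by
  set m := chargeDensity φ with hm
  have hmc : Continuous m := continuous_chargeDensity hφ
  obtain ⟨A, hA⟩ := (hasCompactSupport_chargeDensity hφ).exists_bound_of_continuous hmc
  have hA0 : 0 ≤ A := (norm_nonneg _).trans (hA 0)
  obtain ⟨R, hR2, hR⟩ : ∃ R, 2 ≤ R ∧ ∀ x, m x ≠ 0 → ‖x‖ ≤ R := by
    obtain ⟨R, hR⟩ := (hasCompactSupport_chargeDensity hφ).isCompact.isBounded.exists_norm_le
    exact ⟨max R 2, le_max_right _ _, fun x hx =>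
      (hR x (subset_tsupport _ hx)).trans (le_max_left _ _)⟩
  set ball : Set Plane := Metric.closedBall 0 R with hball
  have hmball : ∀ (f : Plane → ℝ), ∫ x in ball, m x * f x = ∫ x, m x * f x := by
    intro f
    refine setIntegral_eq_integral_of_forall_compl_eq_zero fun x hx => ?_
    have : m x = 0 := by
      by_contra h
      exact hx (by simpa [hball] using hR x h)
    rw [this, zero_mul]
  have hfin : IsFiniteMeasure (volume.restrict ball : Measure Plane) :=
    ⟨by rw [Measure.restrict_apply_univ]; exact (isCompact_closedBall 0 R).measure_lt_top⟩
  let κ : Option Bool → Measure Plane := fun o => o.elim (volume.restrict ball)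
    (fun b => if b then μ.map Subtype.val else ν.map Subtype.val)
  let q : Option Bool → Plane → ℝ := fun o x => o.elim (-s * m x) (fun b => if b then 1 else -1)
  have hmp : IsProbabilityMeasure (μ.map (Subtype.val : Square → Plane)) :=
    Measure.isProbabilityMeasure_map measurable_subtype_coe.aemeasurable
  have hmm : IsProbabilityMeasure (ν.map (Subtype.val : Square → Plane)) :=
    Measure.isProbabilityMeasure_map measurable_subtype_coe.aemeasurable
  have hκ : ∀ i, IsFiniteMeasure (κ i) := by
    rintro (_ | _ | _)
    · simpa [κ] using hfin
    · simp only [κ, Option.elim, Bool.false_eq_true, if_false]; infer_instance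
    · simp only [κ, Option.elim, if_true]; infer_instance
  have hset : MeasurableSet {x : Plane | ‖x‖ ≤ R} :=
    measurableSet_le (by fun_prop) (by fun_prop)
  have hRκ : ∀ i, ∀ᵐ x ∂κ i, ‖x‖ ≤ R := by
    rintro (_ | _ | _)
    · simp only [κ, Option.elim]
      filter_upwards [ae_restrict_mem Metric.isClosed_closedBall.measurableSet] with x hx
      simpa [hball] using hx
    · simp only [κ, Option.elim, Bool.false_eq_true, if_false]
      rw [ae_map_iff measurable_subtype_coe.aemeasurable hset]
      exact Eventually.of_forall fun x => (norm_le_two x).trans hR2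
    · simp only [κ, Option.elim, if_true]
      rw [ae_map_iff measurable_subtype_coe.aemeasurable hset]
      exact Eventually.of_forall fun x => (norm_le_two x).trans hR2
  have hq : ∀ i, Measurable (q i) := by
    rintro (_ | _ | _)
    · exact hmc.measurable.const_mul _
    · exact measurable_const
    · exact measurable_const
  have hqA : ∀ i x, |q i x| ≤ |s| * A + 1 := by
    rintro (_ | _ | _) x
    · simp only [q, Option.elim]
      rw [abs_mul, abs_neg]
      have := mul_le_mul_of_nonneg_left (hA x) (abs_nonneg s)
      rw [Real.norm_eq_abs] at this
      linarith
    · simp [q]; positivity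
    · simp [q]; positivity
  have hmint : ∫ x in ball, m x = 0 := by
    have := hmball fun _ => 1
    simp only [mul_one] at this
    rw [this, hm, integral_chargeDensity hφ]
  have hn : ∑ i, ∫ x, q i x ∂κ i = 0 := by
    have hmint' : ∫ x in ball, -s * m x = 0 := by rw [integral_const_mul, hmint, mul_zero]
    simp only [Fintype.sum_option, q, κ, Option.elim, hmint']
    simp
  have key := sum_logKernel_nonneg κ hq hqA (e := fun _ => τ / 2) (fun _ => by positivity) hRκ hn
  have hU : ∀ (ρ : Measure Square) [IsProbabilityMeasure ρ] (σ : Measure Square) (k : ℝ),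
      ∫ x, k * logPotential ρ τ x ∂(σ.map Subtype.val)
        = k * ∫ x : Square, logPotential ρ τ x.1 ∂σ := by
    intro ρ _ σ k
    rw [integral_map measurable_subtype_coe.aemeasurable
      ((measurable_logPotential ρ τ).const_mul k).aestronglyMeasurable, integral_const_mul]
  have hψ : ∀ x : Plane, ∫ y in ball, m y * logKernel (‖x - y‖ ^ 2 + τ) = mollify τ φ x := by
    intro x
    rw [hmball, mollify]
    simp_rw [norm_sub_rev x]
    rfl
  have hmollm : Measurable (mollify τ φ) := by
    have : Measurable fun p : Plane × Plane => m p.2 * logKernel (‖p.2 - p.1‖ ^ 2 + τ) := by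
      have := hmc.measurable
      fun_prop
    exact this.stronglyMeasurable.integral_prod_right.measurable
  -- The two interaction terms of `m` with a measure agree, by Fubini's theorem.
  have hcross : ∀ (ρ : Measure Square) [IsProbabilityMeasure ρ],
      ∫ x in ball, m x * logPotential ρ τ x = ∫ y : Square, mollify τ φ y.1 ∂ρ := by
    intro ρ _
    simp only [logPotential, ← integral_const_mul]
    rw [integral_integral_swap]
    · refine integral_congr_ae (Eventually.of_forall fun y => ?_)
      exact hmball _
    · refine Integrable.of_bound (C := A * (|logKernel τ| + |logKernel ((R + 2) ^ 2 + τ)|))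
        (Measurable.aestronglyMeasurable ?_) (Eventually.of_forall fun p => ?_)
      · have := hmc.measurable
        simp only [Function.uncurry_def]
        fun_prop
      · simp only [Function.uncurry, norm_mul]
        by_cases hp : m p.1 = 0
        · rw [hp, norm_zero, zero_mul]; positivity
        · refine mul_le_mul (hA _) ?_ (norm_nonneg _) hA0
          refine abs_logKernel_le hτ (by nlinarith [sq_nonneg ‖p.1 - p.2.1‖]) ?_
          have h1 : ‖p.1 - p.2.1‖ ≤ R + 2 :=
            (norm_sub_le _ _).trans (add_le_add (hR _ hp) (norm_le_two _))
          gcongr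
  have hmap : ∀ (ρ : Measure Square) (k : ℝ),
      ∫ x, k * mollify τ φ x ∂(ρ.map Subtype.val) = k * ∫ y : Square, mollify τ φ y.1 ∂ρ := by
    intro ρ k
    rw [integral_map measurable_subtype_coe.aemeasurable
      (hmollm.const_mul k).aestronglyMeasurable, integral_const_mul]
  have hin : ∀ (ρ : Measure Square) (x : Plane) (k : ℝ),
      ∫ y, k * logKernel (‖x - y‖ ^ 2 + τ) ∂(ρ.map Subtype.val) = k * logPotential ρ τ x :=
    fun ρ x k => integral_map_logKernel ρ τ x k
  have hin2 : ∀ (x : Plane) (k : ℝ),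
      ∫ y in ball, k * (-s * m y) * logKernel (‖x - y‖ ^ 2 + τ) = k * (-s) * mollify τ φ x := by
    intro x k
    rw [← hψ, ← integral_const_mul]
    congr 1; ext y; ring
  have hout : ∀ (ρ : Measure Square) [IsProbabilityMeasure ρ] (k : ℝ),
      ∫ x in ball, -s * m x * k * logPotential ρ τ x
        = -s * k * ∫ y : Square, mollify τ φ y.1 ∂ρ := by
    intro ρ _ k
    rw [← hcross, ← integral_const_mul]
    congr 1; ext y; ring
  have hout2 : ∫ x in ball, -s * m x * (-s) * mollify τ φ x
      = s ^ 2 * ∫ x, m x * mollify τ φ x := by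
    rw [← hmball, ← integral_const_mul]
    congr 1; ext y; ring
  simp only [Fintype.sum_option, Fintype.sum_bool, κ, q, Option.elim, if_true,
    Bool.false_eq_true, if_false, add_assoc, add_halves, hin, hin2, hmap, hU, hout, hout2] at key
  have hE : chargeEnergy μ ν τ = (∫ x : Square, logPotential μ τ x.1 ∂μ
      - ∫ x : Square, logPotential ν τ x.1 ∂μ)
      - (∫ x : Square, logPotential μ τ x.1 ∂ν
        - ∫ x : Square, logPotential ν τ x.1 ∂ν) := by
    simp only [chargeEnergy, chargePotential]
    rw [integral_sub (integrable_logPotential μ μ hτ) (integrable_logPotential ν μ hτ),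
      integral_sub (integrable_logPotential μ ν hτ) (integrable_logPotential ν ν hτ)]
  rw [hE]
  linarith

/-- If the regularized energies of `μ - ν` are bounded by `M`, then `μ - ν` has a field of energy at most
`2 π M`: positivity of the energy of `μ - ν - s m` for all `s` bounds `∫ φ d(μ - ν)` by the
Dirichlet norm of `φ`. -/
theorem H_le_of_chargeEnergy_le (μ ν : Measure Square) [IsProbabilityMeasure μ]
    [IsProbabilityMeasure ν] {M : ℝ} (hM : ∀ τ, 0 < τ → chargeEnergy μ ν τ ≤ M) :
    0 ≤ M ∧ H μ ν ≤ ENNReal.ofReal (2 * Real.pi * M) := by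
  have hquad : ∀ (φ : testFunctions) (s : ℝ), 0 ≤ ((2 * Real.pi)⁻¹ * ‖gradLp φ‖ ^ 2) * (s * s)
      + (-(2 * ((2 * Real.pi)⁻¹ * chargeFunctional μ ν φ))) * s + M := by
    rintro ⟨φ, hφ⟩ s
    obtain ⟨B, hB⟩ := exists_bound_of_mem hφ
    have hτ : ∀ n : ℕ, (0 : ℝ) < 1 / ((n : ℝ) + 1) := fun n => by positivity
    have hmeas : ∀ n : ℕ, Measurable (mollify (1 / ((n : ℝ) + 1)) φ) := by
      intro n
      have : Measurable fun p : Plane × Plane =>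
          chargeDensity φ p.2 * logKernel (‖p.2 - p.1‖ ^ 2 + 1 / ((n : ℝ) + 1)) := by
        have := (continuous_chargeDensity hφ).measurable
        fun_prop
      exact this.stronglyMeasurable.integral_prod_right.measurable
    have hlim1 : ∀ (ρ : Measure Square) [IsProbabilityMeasure ρ],
        Tendsto (fun n : ℕ => ∫ y : Square, mollify (1 / ((n : ℝ) + 1)) φ y.1 ∂ρ) atTop
          (𝓝 (∫ y : Square, φ y.1 ∂ρ)) := by
      intro ρ _
      exact tendsto_integral_of_dominated_convergence (fun _ => B)
        (fun n => ((hmeas n).comp measurable_subtype_coe).aestronglyMeasurable)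
        (integrable_const _) (fun n => Eventually.of_forall fun y => abs_mollify_le hφ hB (hτ n) _)
        (Eventually.of_forall fun y => tendsto_mollify hφ _)
    have hlim2 : Tendsto (fun n : ℕ => ∫ x, chargeDensity φ x * mollify (1 / ((n : ℝ) + 1)) φ x)
        atTop (𝓝 (∫ x, chargeDensity φ x * φ x)) := by
      have hint := (continuous_chargeDensity hφ).integrable_of_hasCompactSupport (μ := volume)
        (hasCompactSupport_chargeDensity hφ)
      refine tendsto_integral_of_dominated_convergence (fun x => ‖chargeDensity φ x‖ * B)
        (fun n => ((continuous_chargeDensity hφ).measurable.mul (hmeas n)).aestronglyMeasurable)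
        (hint.norm.mul_const B) (fun n => Eventually.of_forall fun y => ?_)
        (Eventually.of_forall fun y => (tendsto_mollify hφ _).const_mul _)
      rw [norm_mul]
      exact mul_le_mul_of_nonneg_left (abs_mollify_le hφ hB (hτ n) _) (norm_nonneg _)
    have hlim := ((((hlim1 μ).sub (hlim1 ν)).const_mul (2 * s)).const_sub M).add
      (hlim2.const_mul (s ^ 2))
    have h0 := ge_of_tendsto' hlim fun n => (charge_minus_density_energy_nonneg μ ν hφ (hτ n) s).trans
      (by linarith [hM _ (hτ n)] : _ ≤ M
        - 2 * s * (∫ y : Square, mollify (1 / ((n : ℝ) + 1)) φ y.1 ∂μ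
          - ∫ y : Square, mollify (1 / ((n : ℝ) + 1)) φ y.1 ∂ν)
        + s ^ 2 * ∫ x, chargeDensity φ x * mollify (1 / ((n : ℝ) + 1)) φ x)
    rw [integral_chargeDensity_mul hφ] at h0
    have h1 : (2 * Real.pi)⁻¹ * chargeFunctional μ ν ⟨φ, hφ⟩
        = ∫ y : Square, φ y.1 ∂μ - ∫ y : Square, φ y.1 ∂ν := by
      simp only [chargeFunctional, LinearMap.coe_mk, AddHom.coe_mk]
      rw [inv_mul_cancel_left₀ (by positivity)]
    rw [h1]
    linarith
  have hM0 : 0 ≤ M := by simpa using hquad 0 0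
  refine ⟨hM0, ?_⟩
  have h2π : 0 < 2 * Real.pi := by positivity
  have hb : ∀ φ : testFunctions,
      |chargeFunctional μ ν φ| ≤ Real.sqrt (2 * Real.pi * M) * ‖gradLp φ‖ := by
    intro φ
    have h := discrim_le_zero (hquad φ)
    rw [discrim] at h
    refine abs_le_of_sq_le_sq ?_ (by positivity)
    rw [mul_pow, Real.sq_sqrt (by positivity)]
    have h1 : 4 * ((2 * Real.pi)⁻¹) ^ 2 * (chargeFunctional μ ν φ) ^ 2
        ≤ 4 * ((2 * Real.pi)⁻¹) ^ 2 * (2 * Real.pi * M * ‖gradLp φ‖ ^ 2) := by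
      have h2 : 4 * ((2 * Real.pi)⁻¹) ^ 2 * (2 * Real.pi * M * ‖gradLp φ‖ ^ 2)
          = 4 * ((2 * Real.pi)⁻¹ * ‖gradLp φ‖ ^ 2) * M := by
        field_simp
      rw [h2]
      linarith
    exact le_of_mul_le_mul_left h1 (by positivity)
  have := H_le_of_bound μ ν (Real.sqrt_nonneg _) hb
  rwa [Real.sq_sqrt (by positivity)] at this

/-! ### The large deviation upper bound -/

theorem limsup_log_gibbs_le_H {β : ℝ} (hβ : 0 < β) (hβ2 : β < 2) (μ ν : Measure Square)
    [IsProbabilityMeasure μ] [IsProbabilityMeasure ν] :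
    limsup (fun ε : ℝ => limsup (fun N : ℕ => ((1 / (N : ℝ) ^ 2 : ℝ) : EReal) *
        ENNReal.log (gibbs β N (nearEvent N μ ν ε))) atTop) (𝓝[>] (0 : ℝ))
      ≤ -(((β / 2 * (1 / (2 * Real.pi)) : ℝ) : EReal) * (H μ ν : EReal)) := by
  refine EReal.le_of_forall_lt_iff_le.1 fun r hr => ?_
  by_contra hcon
  -- A real number `r` strictly between the two sides bounds all regularized energies.
  have hM : ∀ τ : ℝ, 0 < τ → chargeEnergy μ ν τ ≤ -(2 / β) * r := by
    refine fun τ hτ => chargeEnergy_le_of_forall μ ν (fun τ hτ => ?_) hτ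
    have h2 := (lt_of_not_ge hcon).le.trans (limsup_log_gibbs_le hβ hβ2 μ ν hτ)
    rw [EReal.coe_le_coe_iff] at h2
    have h3 : -(2 / β) * r = (2 / β) * (-r) := by ring
    have h4 : 2 * chargeEnergy μ ν τ - chargeEnergy μ ν (τ + τ)
        = (2 / β) * ((β / 2) * (2 * chargeEnergy μ ν τ - chargeEnergy μ ν (τ + τ))) := by
      field_simp
    rw [h3, h4]
    exact mul_le_mul_of_nonneg_left (by linarith) (by positivity)
  obtain ⟨h0, hH⟩ := H_le_of_chargeEnergy_le μ ν hM
  have h5 : (H μ ν : EReal) ≤ ((2 * Real.pi * (-(2 / β) * r) : ℝ) : EReal) := by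
    refine (EReal.coe_ennreal_le_coe_ennreal_iff.2 hH).trans ?_
    rw [EReal.coe_ennreal_ofReal, max_eq_left (by positivity)]
  have h6 : ((β / 2 * (1 / (2 * Real.pi)) : ℝ) : EReal) * (H μ ν : EReal) ≤ ((-r : ℝ) : EReal) := by
    refine (mul_le_mul_of_nonneg_left h5 (EReal.coe_nonneg.2 (by positivity))).trans (le_of_eq ?_)
    rw [← EReal.coe_mul]
    congr 1
    field_simp
  have h7 := EReal.neg_le_neg_iff.2 h6
  rw [EReal.coe_neg, neg_neg] at h7
  exact absurd hr (not_lt.2 h7)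

end TwoComponentPlasma

end

theorem proposition7p1 (β : ℝ) (hβ0 : 0 < β) (hβ2 : β < 2) :
    (∀ N : ℕ, 1 ≤ N → IsProbabilityMeasure (TwoComponentPlasma.gibbs β N)) ∧
    ∀ (μp μm : Measure TwoComponentPlasma.Square)
      [IsProbabilityMeasure μp] [IsProbabilityMeasure μm],
      (limsup (fun ε : ℝ =>
          limsup (fun N : ℕ =>
            ((1 / (N : ℝ) ^ 2 : ℝ) : EReal) *
              ENNReal.log (TwoComponentPlasma.gibbs β N
                (TwoComponentPlasma.nearEvent N μp μm ε))) atTop) (𝓝[>] (0 : ℝ))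
        ≤ -(((β / 2 * (1 / (2 * Real.pi)) : ℝ) : EReal) *
            (TwoComponentPlasma.H μp μm : EReal))) ∧
      (TwoComponentPlasma.H μp μm < ⊤ →
        ∃ E, TwoComponentPlasma.IsElectricField μp μm E ∧
          TwoComponentPlasma.fieldEnergy E = TwoComponentPlasma.H μp μm) ∧
      (TwoComponentPlasma.H μp μm = 0 ↔ μp = μm) := by
  refine ⟨fun N hN => TwoComponentPlasma.isProbabilityMeasure_gibbs hβ0 hβ2 hN,
    fun μp μm _ _ => ⟨?_, ?_, ?_⟩⟩
  · exact TwoComponentPlasma.limsup_log_gibbs_le_H hβ0 hβ2 μp μm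
  · exact TwoComponentPlasma.exists_minimizer μp μm
  · exact TwoComponentPlasma.H_eq_zero_iff μp μm
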